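/- **Definitions.** *Algorithms.* An algorithm is a randomised program over finitely many stacks of bits. In one step it can push or pop a bit, test the top of a stack, push a fair random bit, or push the bits of a fresh sample from the unknown distribution. It runs in time $t$ if it halts within $t$ steps for all outcomes of its coins and samples. *Noisy parity.* For $y\in\{0,1\}^n$ and $p\in(0,1/2)$, the noisy parity distribution with hidden vector $y$ and noise rate $p$ is the law on $\{0,1\}^{n+1}$ of $(z,b)$, where $z\in\{0,1\}^n$ is uniform, $b=\langle y,z\rangle \bmod 2$ with probability $1-p$ and $b=1-(\langle y,z\rangle\bmod 2)$ with probability $p$. For a set $P\subseteq(0,1/2)$ of noise rates, *noisy parity is hard for $P$* if there are no algorithm $S$ and polynomial $q$ such that for all $n\ge 1$, $y\in\{0,1\}^n$ and $p\in P$, on input $1^n$ and with samples from the noisy parity distribution with hidden vector $y$ and rate $p$ (the rate is not given to $S$), $S$ runs in time $q(n)$ and with probability at least $2/3$ outputs $\hat y\in\{0,1\}^n$ with $|y\oplus\hat y|<n/4$. *Time-varying ISANs.* A time-varying ISAN of sequence length $T$ and hidden dimension $d$ over a finite alphabet $\Sigma$ consists of matrices $A_{z,t}\in\mathbb R^{d\times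 d}$, $B_t\in\mathbb R^{\Sigma\times d}$ ($z\in\Sigma$, $1\le t\le T$) and $x_0\in\mathbb R^d$. It generates $z_1\dots z_T\in\Sigma^T$ by sampling $z_t\sim\mathrm{softmax}(B_tx_{t-1})$ and setting $x_t=A_{z_t,t}x_{t-1}$. *Learning.* An algorithm $L$ *learns the time-varying ISANs with alphabet size $k$ and hidden dimension $d$ up to $\epsilon$ in polynomial time* if there are a polynomial $q$ and a deterministic polynomial-time evaluator $E$ such that for every $T$ and every such ISAN $M$ of sequence length $T$, on input $(1^T,1^d,1^k)$ and with samples from $M$, $L$ runs in time $q(T)$ and with probability at least $2/3$ outputs a string $w$ that describes some distribution $Q$ on $\Sigma^T$ with $D_{\mathrm{TV}}(Q,M)\le\epsilon$. Here $w$ describes $Q$ if, for all $x\in\Sigma^T$ and $m\ge0$, $E$ on input $(w,x,1^m)$ computes $Q(x)$ up to an additive error of $2^{-m}$; the running time of $E$ is polynomial in $|w|+|x|+m$. ($Q$ need not be generated by an ISAN.) **Theorem.** Let $p_0<1/2$. There is a constant $\epsilon>0$, depending only on $p_0$, such that for every set $P\subseteq(0,p_0]$ of noise rates (for instance $P=\{p_0\}$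 when $p_0>0$): if noisy parity is hard for $P$, then there is no polynomial-time algorithm that, given samples from a time-varying ISAN, learns it up to $\epsilon$ in total variation distance, not even for the binary alphabet and hidden dimension $2$. (A fortiori, there is none that does so for all alphabet sizes and all hidden dimensions.) -/

import Mathlib

/-! ## Randomised programs over bit stacks, with a step count -/

/-- Programs of a small imperative language. The memory consists of registers `0, 1, 2, …`, each
of them a stack of bits; a program mentions only finitely many of them. Besides the usual
constructs a program may toss a fair coin and may draw a fresh sample from the unknown
distribution. -/
inductive Prog : Type
  | skip : Prog
  /-- Put the bit `b` on top of register `r`. -/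
  | push (r : ℕ) (b : Bool) : Prog
  /-- Remove the top bit of register `r` (no effect if the register is empty). -/
  | pop (r : ℕ) : Prog
  /-- Put a uniformly random bit on top of register `r`. -/
  | flip (r : ℕ) : Prog
  /-- Draw a fresh sample and put its bits on top of register `r`, first bit topmost. -/
  | draw (r : ℕ) : Prog
  /-- Run `a`, then `b`. -/
  | seq (a b : Prog) : Prog
  /-- Look at the top of register `r`, without removing it: run `e` if the register is empty,
  `z` if its top bit is `false`, and `o` if its top bit is `true`. -/
  | branch (r : ℕ) (e z o : Prog) : Prog
  /-- Repeat `a` as long as register `r` is not empty. -/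
  | loop (r : ℕ) (a : Prog) : Prog

namespace Prog

/-- Contents of the registers. -/
abbrev Memory : Type := ℕ → List Bool

/-- A configuration of the machine: the programs still to be run, in this order, and the memory.
The machine has halted when nothing is left to be run. -/
abbrev Config : Type := List Prog × Memory

/-- One step of the machine, when samples are drawn from `D`. -/
noncomputable def step (D : PMF (List Bool)) : Config → PMF Config
  | ([], s) => PMF.pure ([], s)
  | (skip :: k, s) => PMF.pure (k, s)
  | (push r b :: k, s) => PMF.pure (k, Function.update s r (b :: s r))
  | (pop r :: k, s) => PMF.pure (k, Function.update s r (s r).tail)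
  | (flip r :: k, s) =>
      (PMF.uniformOfFintype Bool).map fun b => (k, Function.update s r (b :: s r))
  | (draw r :: k, s) => D.map fun x => (k, Function.update s r (x ++ s r))
  | (seq a b :: k, s) => PMF.pure (a :: b :: k, s)
  | (branch r e z o :: k, s) =>
      PMF.pure
        (match s r with
          | [] => (e :: k, s)
          | false :: _ => (z :: k, s)
          | true :: _ => (o :: k, s))
  | (loop r a :: k, s) =>
      PMF.pure
        (match s r with
          | [] => (k, s)
          | _ :: _ => (a :: loop r a :: k, s))

/-- The random configuration after `t` steps. -/
noncomputable def run (D : PMF (List Bool)) : ℕ → Config → PMF Config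
  | 0, c => PMF.pure c
  | t + 1, c => (step D c).bind (run D t)

/-- Started with memory `s`, the program halts within `t` steps, whatever the outcomes of the coin
tosses and of the draws are. -/
def HaltsIn (D : PMF (List Bool)) (a : Prog) (s : Memory) (t : ℕ) : Prop :=
  ∀ c ∈ (run D t ([a], s)).support, c.1 = []

/-- The distribution of the content of register `0` (the output) after `t` steps. -/
noncomputable def output (D : PMF (List Bool)) (a : Prog) (s : Memory) (t : ℕ) :
    PMF (List Bool) :=
  (run D t ([a], s)).map fun c => c.2 0

/-- The program uses neither coins nor samples. -/
def Deterministic : Prog → Prop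
  | skip => True
  | push _ _ => True
  | pop _ => True
  | flip _ => False
  | draw _ => False
  | seq a b => a.Deterministic ∧ b.Deterministic
  | branch _ e z o => e.Deterministic ∧ z.Deterministic ∧ o.Deterministic
  | loop _ a => a.Deterministic

/-- The memory with the listed contents in registers `0, 1, 2, …`, all other registers empty. -/
def input (l : List (List Bool)) : Memory := fun r => l.getD r []

/-- A number written in unary. -/
def unary (n : ℕ) : List Bool := List.replicate n true

/-- The number with given binary digits, least significant digit first. -/
def toNat (l : List Bool) : ℕ := Nat.ofDigits 2 (l.map Bool.toNat)

end Prog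

/-! ## Noisy parity -/

/-- The parity `⟨y, z⟩ mod 2`. -/
def parity {n : ℕ} (y z : Fin n → Bool) : Bool :=
  decide (Odd (∑ i, (y i).toNat * (z i).toNat))

/-- A coin that shows `true` with probability `p`. -/
noncomputable def biasedCoin (p : Set.Ioo (0 : ℝ) (1 / 2)) : PMF Bool :=
  PMF.ofFintype (fun e => ENNReal.ofReal (if e then (p : ℝ) else 1 - p)) (by
    obtain ⟨p, h0, h1⟩ := p
    rw [Fintype.sum_bool, if_pos rfl, if_neg Bool.false_ne_true,
      ← ENNReal.ofReal_add h0.le (by linarith), add_sub_cancel, ENNReal.ofReal_one])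

/-- The noisy parity distribution over `{0,1}^(n+1)` with hidden vector `y` and noise rate `p`:
`z` is uniform, and it is followed by `⟨y, z⟩ mod 2`, flipped with probability `p`. -/
noncomputable def noisyParity {n : ℕ} (y : Fin n → Bool) (p : Set.Ioo (0 : ℝ) (1 / 2)) :
    PMF (Fin (n + 1) → Bool) :=
  (PMF.uniformOfFintype (Fin n → Bool)).bind fun z =>
    (biasedCoin p).map fun e => Fin.snoc z (xor (parity y z) e)

/-- The program `S` solves noisy parity for all noise rates in `P` in polynomial time: on input
`1ⁿ`, and with access to samples from a noisy parity distribution with hidden vector `y` and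
noise rate in `P`, it halts within `q n` steps, and with probability at least `2/3` it outputs a
vector that differs from `y` in less than `n / 4` coordinates. -/
def SolvesNoisyParity (P : Set (Set.Ioo (0 : ℝ) (1 / 2))) (S : Prog) : Prop :=
  ∃ q : Polynomial ℕ, ∀ n : ℕ, 0 < n → ∀ y : Fin n → Bool, ∀ p ∈ P,
    let D : PMF (List Bool) := (noisyParity y p).map List.ofFn
    let s : Prog.Memory := Prog.input [Prog.unary n]
    Prog.HaltsIn D S s (q.eval n) ∧
      2 / 3 ≤ (Prog.output D S s (q.eval n)).toOuterMeasure
        {w | ∃ y' : Fin n → Bool, w = List.ofFn y' ∧ 4 * hammingDist y y' < n}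

/-- Hardness of noisy parity: no polynomial-time program solves it for all noise rates in `P`. -/
def NoisyParityHard (P : Set (Set.Ioo (0 : ℝ) (1 / 2))) : Prop :=
  ¬ ∃ S : Prog, SolvesNoisyParity P S

/-! ## Time-varying ISANs -/

/-- The softmax distribution with logits `v`. -/
noncomputable def softmax {α : Type} [Fintype α] [Nonempty α] (v : α → ℝ) : PMF α :=
  PMF.ofFintype (fun a => ENNReal.ofReal (Real.exp (v a) / ∑ b, Real.exp (v b))) (by
    have hpos : 0 < ∑ b, Real.exp (v b) :=
      Finset.sum_pos (fun b _ => Real.exp_pos _) Finset.univ_nonempty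
    rw [← ENNReal.ofReal_sum_of_nonneg (fun a _ => by positivity), ← Finset.sum_div,
      div_self hpos.ne', ENNReal.ofReal_one])

/-- A time-varying ISAN over the alphabet `α` with hidden dimension `d` and sequence length `T`.
Times are numbered from `0`: the matrices `A z t` and `B t` are those of time step `t + 1`. -/
structure TimeVaryingISAN (α : Type) (d T : ℕ) where
  A : α → Fin T → Matrix (Fin d) (Fin d) ℝ
  B : Fin T → Matrix α (Fin d) ℝ
  x₀ : Fin d → ℝ

namespace TimeVaryingISAN

/-- What remains of the ISAN after the first token has been `z`. -/
def next {α : Type} {d T : ℕ} (M : TimeVaryingISAN α d (T + 1)) (z : α) :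
    TimeVaryingISAN α d T where
  A := fun a t => M.A a t.succ
  B := fun t => M.B t.succ
  x₀ := (M.A z 0).mulVec M.x₀

/-- The distribution over sequences of `T` tokens that the ISAN generates: each token is sampled
from the softmax of `B x`, then the hidden state `x` is multiplied by the matrix `A` of this
token. -/
noncomputable def dist {α : Type} [Fintype α] [Nonempty α] {d : ℕ} :
    {T : ℕ} → TimeVaryingISAN α d T → PMF (Fin T → α)
  | 0, _ => PMF.pure Fin.elim0
  | _ + 1, M =>
      (softmax ((M.B 0).mulVec M.x₀)).bind fun z => (M.next z).dist.map fun f => Fin.cons z f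

end TimeVaryingISAN

/-! ## Learning a distribution from samples -/

/-- Total variation distance. -/
noncomputable def tvDist {α : Type} [Fintype α] (μ ν : PMF α) : ℝ :=
  (1 / 2) * ∑ a, |(μ a).toReal - (ν a).toReal|

/-- A sequence of tokens as a bit string, each token in binary (least significant bit first) with
`⌈log₂ k⌉` bits; for `k = 2` one bit per token. -/
def encodeTokens {k T : ℕ} (x : Fin T → Fin k) : List Bool :=
  (List.ofFn x).flatMap fun i => List.ofFn fun j : Fin (Nat.clog 2 k) => (i : ℕ).testBit j

/-- `E` is a polynomial-time evaluator: a deterministic program that on input `(w, x, 1ᵐ)` halts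
within polynomially many steps. -/
def IsEvaluator (E : Prog) : Prop :=
  E.Deterministic ∧ ∃ q : Polynomial ℕ, ∀ (w x : List Bool) (m : ℕ),
    Prog.HaltsIn (PMF.pure []) E (Prog.input [w, x, Prog.unary m])
      (q.eval (w.length + x.length + m))

/-- The string `w` describes the distribution `Q`, when it is read by the evaluator `E`: on input
`(w, x, 1ᵐ)`, the program `E` computes the probability `Q x` up to `2⁻ᵐ`, as a dyadic
number `N / 2ᵐ` with `N` written in binary. -/
def Describes (E : Prog) (w : List Bool) {k T : ℕ} (Q : PMF (Fin T → Fin k)) : Prop :=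
  ∀ (x : Fin T → Fin k) (m : ℕ), ∃ (t : ℕ) (s : Prog.Memory),
    Prog.run (PMF.pure []) t ([E], Prog.input [w, encodeTokens x, Prog.unary m]) =
        PMF.pure ([], s) ∧
      |(Prog.toNat (s 0) : ℝ) / 2 ^ m - (Q x).toReal| ≤ 1 / 2 ^ m

/-- The program `L` learns, in polynomial time and up to `ε` in total variation distance, the
time-varying ISANs with hidden dimension `d` over an alphabet of size `k`: on input
`(1ᵀ, 1ᵈ, 1ᵏ)`, and with access to samples from such an ISAN of sequence length `T`, it halts
within `q T` steps, and with probability at least `2/3` it outputs a description (with respect to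
the polynomial-time evaluator `E`) of a distribution within `ε` of that of the ISAN. The learnt
distribution need not be that of an ISAN. -/
def LearnsISANs (k d : ℕ) [NeZero k] (ε : ℝ) (L E : Prog) : Prop :=
  IsEvaluator E ∧ ∃ q : Polynomial ℕ, ∀ (T : ℕ) (M : TimeVaryingISAN (Fin k) d T),
    let D : PMF (List Bool) := M.dist.map encodeTokens
    let s : Prog.Memory := Prog.input [Prog.unary T, Prog.unary d, Prog.unary k]
    Prog.HaltsIn D L s (q.eval T) ∧
      2 / 3 ≤ (Prog.output D L s (q.eval T)).toOuterMeasure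
        {w | ∃ Q : PMF (Fin T → Fin k), Describes E w Q ∧ tvDist Q M.dist ≤ ε}

/-! Noisy parity is itself generated by an ISAN over two tokens with hidden dimension 2. The state
is `(±1, 0)`, whose sign is the parity of the bits selected so far; all logits vanish except at the
last time, where the logit of token 1 is minus the sign times `log ((1 - p) / p)`. Hence a learner L
for ISANs can be run on noisy parity samples, and with probability at least 2/3 it returns a
description of some Q close to the noisy parity law M. Write γ = 1/2 - p₀ and ε = γ/1600. The mass
M(z,1) is 2⁻ⁿ(1-p) or 2⁻ⁿp according to the parity of z, so comparing Q(z,1) with 2⁻ⁿ/2 guesses this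
parity, with a threshold that does not involve p. The evaluator is asked for precision 2⁻⁽ⁿ⁺¹⁺ᶜ⁾,
with c so large that rounding costs at most half of the gap γ. A wrong guess at z then forces |Q -
M| ≥ 2⁻ⁿγ/2 at (z,1). These differences sum to at most 2ε, so at most 2ⁿ/400 guesses are wrong
(`card_ne_parity_le`). Guess coordinate i of the hidden vector as h(z) ⊕ h(z with bit i negated),
for a uniform z taken from one more sample. It is wrong only if one of these two guesses of h is.
Averaging over z and Markov's inequality show that for all but 1/25 of the z fewer than n/8
coordinates are wrong (`card_hiddenGuess_le`). One round thus succeeds with probability at least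
(2/3)(24/25) = 16/25. Three independent rounds and a coordinatewise majority bring this back above
2/3: where two vectors agree with y so does the majority, hence two good rounds leave fewer than n/4
errors. This is why one round aims at n/8. The rest makes this an explicit program with a polynomial
step count. L and E are black boxes that use only registers below some N, and a frame rule
(`run_mem`) protects the data stored from N on. What they leave behind is bounded by their running
time, so it can be erased before the next call (`length_le_of_mem_support_run`). -/

theorem PMF.bind_congr_support {α β : Type*} (p : PMF α) {f g : α → PMF β}
    (h : ∀ a ∈ p.support, f a = g a) : p.bind f = p.bind g := by
  ext b
  simp only [PMF.bind_apply]
  refine tsum_congr fun a => ?_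
  by_cases ha : p a = 0
  · simp [ha]
  · rw [h a ((PMF.mem_support_iff _ _).2 ha)]

theorem PMF.map_congr_support {α β : Type*} (p : PMF α) {f g : α → β}
    (h : ∀ a ∈ p.support, f a = g a) : p.map f = p.map g :=
  p.bind_congr_support fun a ha => by simp [h a ha]

namespace Prog

/-! ### Running lists of programs -/

/-- Every outcome of running the programs `k` for `t` steps from memory `s` has halted. -/
def Halts (D : PMF (List Bool)) (k : List Prog) (s : Memory) (t : ℕ) : Prop :=
  ∀ c ∈ (run D t (k, s)).support, c.1 = []

theorem run_nil (D : PMF (List Bool)) (t : ℕ) (s : Memory) :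
    run D t ([], s) = PMF.pure ([], s) := by
  induction t with
  | zero => rfl
  | succ t ih => simp [run, step, ih]

theorem run_add (D : PMF (List Bool)) (t u : ℕ) (c : Config) :
    run D (t + u) c = (run D t c).bind (run D u) := by
  induction t generalizing c with
  | zero => simp [run]
  | succ t ih =>
    rw [Nat.succ_add]
    simp only [run, PMF.bind_bind]
    exact congrArg _ (funext ih)

theorem Halts.run_add {D : PMF (List Bool)} {k : List Prog} {s : Memory} {t : ℕ}
    (h : Halts D k s t) (u : ℕ) : run D (t + u) (k, s) = run D t (k, s) := by
  rw [Prog.run_add]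
  conv_rhs => rw [← PMF.bind_pure (run D t (k, s))]
  refine PMF.bind_congr_support _ fun c hc => ?_
  obtain ⟨k', s'⟩ := c
  obtain rfl : k' = [] := h _ hc
  exact run_nil D u s'

theorem Halts.run_eq {D : PMF (List Bool)} {k : List Prog} {s : Memory} {t u : ℕ}
    (h : Halts D k s t) (htu : t ≤ u) : run D u (k, s) = run D t (k, s) := by
  obtain ⟨v, rfl⟩ := Nat.exists_eq_add_of_le htu
  exact h.run_add v

/-- A step consults only the head of the list of pending programs, so a tail rides along untouched.
-/
theorem step_append (D : PMF (List Bool)) (a : Prog) (k l : List Prog) (s : Memory) :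
    step D (a :: k ++ l, s) = (step D (a :: k, s)).map fun c => (c.1 ++ l, c.2) := by
  cases a with
  | skip | push | pop | seq => simp [step, PMF.pure_map]
  | flip | draw => simp [step, PMF.map_comp, Function.comp_def]
  | branch r => rcases h : s r with _ | ⟨_ | _, _⟩ <;> simp [step, PMF.pure_map, h]
  | loop r => rcases h : s r with _ | ⟨_, _⟩ <;> simp [step, PMF.pure_map, h]

/-- Here `t` is only an upper bound for the time of `k`, and `l` starts as soon as `k` is finished.
The surplus steps do no harm because a halted configuration is a fixed point. -/
theorem Halts.run_append {D : PMF (List Bool)} {k l : List Prog} {s : Memory} {t u : ℕ}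
    (h : Halts D k s t) (hl : ∀ c ∈ (run D t (k, s)).support, Halts D l c.2 u) :
    run D (t + u) (k ++ l, s) = (run D t (k, s)).bind fun c => run D u (l, c.2) := by
  induction t generalizing k s with
  | zero =>
    obtain rfl : k = [] := h (k, s) (by simp [run])
    simp [run]
  | succ t ih =>
    cases k with
    | nil =>
      simp only [run_nil, PMF.pure_bind, List.nil_append]
      exact (hl ([], s) (by simp [run_nil])).run_eq (by omega)
    | cons a k =>
      rw [Nat.succ_add]
      simp only [run, PMF.bind_bind]
      rw [step_append, PMF.bind_map]
      refine PMF.bind_congr_support _ fun c hc => ?_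
      have hsub : ∀ c' ∈ (run D t c).support, c' ∈ (run D (t + 1) (a :: k, s)).support := by
        intro c' hc'
        simp only [run, PMF.mem_support_bind_iff]
        exact ⟨c, hc, hc'⟩
      exact ih (fun c' hc' => h c' (hsub c' hc')) fun c' hc' => hl c' (hsub c' hc')

/-! ### Distribution of the final memory and of the output -/

/-- The program `a`, started with memory `s`, halts within `t` steps, and `μ` is the distribution
of the memory at the end. -/
def Ends (D : PMF (List Bool)) (a : Prog) (s : Memory) (t : ℕ) (μ : PMF Memory) : Prop :=
  run D t ([a], s) = μ.map (Prod.mk [])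

/-- The program `a`, started with memory `s`, halts within `t` steps, and `ν` is the distribution
of its output. -/
def Outputs (D : PMF (List Bool)) (a : Prog) (s : Memory) (t : ℕ) (ν : PMF (List Bool)) : Prop :=
  HaltsIn D a s t ∧ output D a s t = ν

/-- Whatever the distribution of the samples is, the program `a`, started with memory `s`, halts
within `t` steps with memory `s'`. -/
def Runs (a : Prog) (s : Memory) (t : ℕ) (s' : Memory) : Prop :=
  ∀ D : PMF (List Bool), run D t ([a], s) = PMF.pure ([], s')

theorem Ends.halts {D : PMF (List Bool)} {a : Prog} {s : Memory} {t : ℕ} {μ : PMF Memory}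
    (h : Ends D a s t μ) : Halts D [a] s t := by
  intro c hc
  rw [h, PMF.mem_support_map_iff] at hc
  obtain ⟨s', -, rfl⟩ := hc
  rfl

theorem Ends.mono {D : PMF (List Bool)} {a : Prog} {s : Memory} {t u : ℕ} {μ : PMF Memory}
    (h : Ends D a s t μ) (htu : t ≤ u) : Ends D a s u μ :=
  (h.halts.run_eq htu).trans h

theorem Ends.mem_support {D : PMF (List Bool)} {a : Prog} {s s' : Memory} {t : ℕ} {μ : PMF Memory}
    (h : Ends D a s t μ) (hs : s' ∈ μ.support) : ([], s') ∈ (run D t ([a], s)).support := by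
  rw [h, PMF.mem_support_map_iff]
  exact ⟨s', hs, rfl⟩

theorem HaltsIn.ends {D : PMF (List Bool)} {a : Prog} {s : Memory} {t : ℕ}
    (h : HaltsIn D a s t) : Ends D a s t ((run D t ([a], s)).map Prod.snd) := by
  unfold Ends
  rw [PMF.map_comp]
  conv_lhs => rw [← PMF.map_id (run D t ([a], s))]
  refine PMF.map_congr_support _ fun c hc => ?_
  obtain ⟨k', s'⟩ := c
  obtain rfl : k' = [] := h _ hc
  rfl

theorem Ends.outputs {D : PMF (List Bool)} {a : Prog} {s : Memory} {t : ℕ} {μ : PMF Memory}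
    (h : Ends D a s t μ) : Outputs D a s t (μ.map fun s => s 0) := by
  refine ⟨h.halts, ?_⟩
  rw [output, h, PMF.map_comp]
  rfl

theorem Outputs.ends {D : PMF (List Bool)} {a : Prog} {s : Memory} {t : ℕ} {ν : PMF (List Bool)}
    (h : Outputs D a s t ν) : ∃ μ, Ends D a s t μ ∧ μ.map (fun s => s 0) = ν :=
  ⟨_, h.1.ends, by rw [← h.2, output, PMF.map_comp]; rfl⟩

theorem Outputs.mono {D : PMF (List Bool)} {a : Prog} {s : Memory} {t u : ℕ}
    {ν : PMF (List Bool)} (h : Outputs D a s t ν) (htu : t ≤ u) : Outputs D a s u ν := by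
  obtain ⟨μ, hμ, rfl⟩ := h.ends
  exact (hμ.mono htu).outputs

theorem Runs.ends {a : Prog} {s s' : Memory} {t : ℕ} (h : Runs a s t s') (D : PMF (List Bool)) :
    Ends D a s t (PMF.pure s') := by
  rw [Ends, h D, PMF.pure_map]

theorem Runs.mono {a : Prog} {s s' : Memory} {t u : ℕ} (h : Runs a s t s') (htu : t ≤ u) :
    Runs a s u s' := fun D => by
  rw [((h.ends D).mono htu : run D u _ = _), PMF.pure_map]

/-! ### Sequential composition -/

theorem Ends.seq {D : PMF (List Bool)} {a b : Prog} {s : Memory} {t u : ℕ} {μ : PMF Memory}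
    {κ : Memory → PMF Memory} (ha : Ends D a s t μ)
    (hb : ∀ s' ∈ μ.support, Ends D b s' u (κ s')) :
    Ends D (Prog.seq a b) s (t + u + 1) (μ.bind κ) := by
  have hsupp : ∀ c ∈ (run D t ([a], s)).support, Halts D [b] c.2 u := by
    intro c hc
    rw [ha, PMF.mem_support_map_iff] at hc
    obtain ⟨s', hs', rfl⟩ := hc
    exact (hb s' hs').halts
  have key := ha.halts.run_append hsupp
  unfold Ends
  simp only [run, step, PMF.pure_bind]
  refine key.trans ?_
  rw [ha, PMF.bind_map, PMF.map_bind]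
  exact PMF.bind_congr_support _ fun s' hs' => hb s' hs'

theorem Ends.seq_outputs {D : PMF (List Bool)} {a b : Prog} {s : Memory} {t u : ℕ}
    {μ : PMF Memory} {κ : Memory → PMF (List Bool)} (ha : Ends D a s t μ)
    (hb : ∀ s' ∈ μ.support, Outputs D b s' u (κ s')) :
    Outputs D (Prog.seq a b) s (t + u + 1) (μ.bind κ) := by
  have h := (ha.seq fun s' hs' => (hb s' hs').1.ends).outputs
  rw [PMF.map_bind] at h
  have e : (μ.bind fun s' => ((run D u ([b], s')).map Prod.snd).map fun s => s 0) = μ.bind κ :=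
    PMF.bind_congr_support _ fun s' hs' => by
      rw [← (hb s' hs').2, output, PMF.map_comp]; rfl
  rwa [e] at h

theorem Runs.seq {a b : Prog} {s s' s'' : Memory} {t u : ℕ} (ha : Runs a s t s')
    (hb : Runs b s' u s'') : Runs (Prog.seq a b) s (t + u + 1) s'' := fun D => by
  have h := (ha.ends D).seq (κ := fun _ => PMF.pure s'') (b := b) (u := u) (by
    intro r hr
    rw [PMF.support_pure, Set.mem_singleton_iff] at hr
    exact hr ▸ hb.ends D)
  rw [(h : run D _ _ = _), PMF.pure_bind, PMF.pure_map]

theorem Runs.seq_ends {D : PMF (List Bool)} {a b : Prog} {s s' : Memory} {t u : ℕ} {μ : PMF Memory}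
    (ha : Runs a s t s') (hb : Ends D b s' u μ) :
    Ends D (Prog.seq a b) s (t + u + 1) μ := by
  have h := (ha.ends D).seq (κ := fun _ => μ) (b := b) (u := u) (by
    intro r hr
    rw [PMF.support_pure, Set.mem_singleton_iff] at hr
    exact hr ▸ hb)
  rwa [PMF.pure_bind] at h

theorem Runs.seq_outputs {D : PMF (List Bool)} {a b : Prog} {s s' : Memory} {t u : ℕ}
    {ν : PMF (List Bool)} (ha : Runs a s t s') (hb : Outputs D b s' u ν) :
    Outputs D (Prog.seq a b) s (t + u + 1) ν := by
  obtain ⟨μ, hμ, rfl⟩ := hb.ends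
  exact (ha.seq_ends hμ).outputs

/-! ### The single instructions -/

theorem runs_skip (s : Memory) : Runs skip s 1 s := fun D => by simp [run, step]

theorem runs_push (r : ℕ) (b : Bool) (s : Memory) :
    Runs (push r b) s 1 (Function.update s r (b :: s r)) := fun D => by simp [run, step]

theorem runs_pop (r : ℕ) (s : Memory) :
    Runs (pop r) s 1 (Function.update s r (s r).tail) := fun D => by simp [run, step]

theorem ends_draw (D : PMF (List Bool)) (r : ℕ) (s : Memory) :
    Ends D (draw r) s 1 (D.map fun x => Function.update s r (x ++ s r)) := by
  simp [Ends, run, step, Function.comp_def, PMF.map, PMF.bind_bind]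

theorem Runs.branch_nil {r : ℕ} {e z o : Prog} {s s' : Memory} {t : ℕ} (hr : s r = [])
    (h : Runs e s t s') : Runs (branch r e z o) s (t + 1) s' := fun D => by
  simp [run, step, hr, h D]

theorem Runs.branch_false {r : ℕ} {e z o : Prog} {s s' : Memory} {t : ℕ} {l : List Bool}
    (hr : s r = false :: l) (h : Runs z s t s') : Runs (branch r e z o) s (t + 1) s' := fun D => by
  simp [run, step, hr, h D]

theorem Runs.branch_true {r : ℕ} {e z o : Prog} {s s' : Memory} {t : ℕ} {l : List Bool}
    (hr : s r = true :: l) (h : Runs o s t s') : Runs (branch r e z o) s (t + 1) s' := fun D => by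
  simp [run, step, hr, h D]

theorem runs_loop_nil {r : ℕ} {a : Prog} {s : Memory} (hr : s r = []) :
    Runs (loop r a) s 1 s := fun D => by
  simp [run, step, hr]

theorem Runs.loop_cons {r : ℕ} {a : Prog} {s s' s'' : Memory} {t u : ℕ} (hr : s r ≠ [])
    (ha : Runs a s t s') (hl : Runs (loop r a) s' u s'') :
    Runs (loop r a) s (t + u + 1) s'' := fun D => by
  have h := ha.seq hl D
  obtain ⟨b, l, hbl⟩ := List.exists_cons_of_ne_nil hr
  simp only [run, step, PMF.pure_bind, hbl] at h ⊢
  exact h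

/-! ### Frame rule and growth of the registers -/

/-- The program mentions only registers below `N`. -/
def Below (N : ℕ) : Prog → Prop
  | skip => True
  | push r _ => r < N
  | pop r => r < N
  | flip r => r < N
  | draw r => r < N
  | seq a b => a.Below N ∧ b.Below N
  | branch r e z o => r < N ∧ e.Below N ∧ z.Below N ∧ o.Below N
  | loop r a => r < N ∧ a.Below N

theorem Below.mono {N N' : ℕ} (h : N ≤ N') {a : Prog} (ha : a.Below N) : a.Below N' := by
  induction a with
  | skip => trivial
  | push | pop | flip | draw => exact lt_of_lt_of_le ha h
  | seq a b iha ihb => exact ⟨iha ha.1, ihb ha.2⟩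
  | branch r e z o ihe ihz iho =>
    exact ⟨lt_of_lt_of_le ha.1 h, ihe ha.2.1, ihz ha.2.2.1, iho ha.2.2.2⟩
  | loop r a iha => exact ⟨lt_of_lt_of_le ha.1 h, iha ha.2⟩

theorem exists_below (a : Prog) : ∃ N, a.Below N := by
  induction a with
  | skip => exact ⟨0, trivial⟩
  | push r | pop r | flip r | draw r => exact ⟨r + 1, Nat.lt_succ_self r⟩
  | seq a b iha ihb =>
    obtain ⟨A, hA⟩ := iha
    obtain ⟨B, hB⟩ := ihb
    exact ⟨max A B, hA.mono (by simp), hB.mono (by simp)⟩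
  | branch r e z o ihe ihz iho =>
    obtain ⟨A, hA⟩ := ihe
    obtain ⟨B, hB⟩ := ihz
    obtain ⟨C, hC⟩ := iho
    exact ⟨r + 1 + A + B + C, by show r < _; omega, hA.mono (by omega), hB.mono (by omega),
      hC.mono (by omega)⟩
  | loop r a iha =>
    obtain ⟨A, hA⟩ := iha
    exact ⟨r + 1 + A, by show r < _; omega, hA.mono (by omega)⟩

/-- The memory with the registers below `N` as in `u` and the others as listed in `l`. -/
def mem (N : ℕ) (u : Memory) (l : List (List Bool)) : Memory :=
  fun r => if r < N then u r else l.getD (r - N) []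

theorem mem_low {N : ℕ} (u : Memory) (l : List (List Bool)) {r : ℕ} (h : r < N) :
    mem N u l r = u r := if_pos h

theorem mem_high (N : ℕ) (u : Memory) (l : List (List Bool)) (i : ℕ) :
    mem N u l (N + i) = l.getD i [] := by simp [mem]

theorem update_mem_low {N : ℕ} (u : Memory) (l : List (List Bool)) {r : ℕ} (h : r < N)
    (v : List Bool) : Function.update (mem N u l) r v = mem N (Function.update u r v) l := by
  funext j
  by_cases hj : j = r
  · subst hj; simp [mem, h]
  · simp [mem, hj]

theorem update_mem_high (N : ℕ) (u : Memory) (l : List (List Bool)) {i : ℕ} (h : i < l.length)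
    (v : List Bool) : Function.update (mem N u l) (N + i) v = mem N u (l.set i v) := by
  funext j
  by_cases hj : j = N + i
  · subst hj; simp [mem, h]
  · by_cases hN : j < N
    · simp [mem, hj, hN]
    · have : i ≠ j - N := by omega
      simp [mem, hj, hN, List.getD_eq_getElem?_getD, List.getElem?_set_ne this]

/-- The frame rule for one step: programs below `N` neither read nor write the registers listed in
`l`. -/
theorem step_mem {N : ℕ} (D : PMF (List Bool)) (l : List (List Bool)) {k : List Prog}
    (hk : ∀ a ∈ k, a.Below N) (u : Memory) :
    step D (k, mem N u l) = (step D (k, u)).map fun c => (c.1, mem N c.2 l) := by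
  cases k with
  | nil => simp [step, PMF.pure_map]
  | cons a k =>
    have ha := hk a (by simp)
    cases a with
    | skip => simp [step, PMF.pure_map]
    | seq => simp [step, PMF.pure_map]
    | push r | pop r =>
      have hr : r < N := ha
      simp [step, PMF.pure_map, update_mem_low _ _ hr, mem_low _ _ hr]
    | flip r | draw r =>
      have hr : r < N := ha
      simp [step, PMF.map_comp, Function.comp_def, update_mem_low _ _ hr, mem_low _ _ hr]
    | branch r =>
      have hr : r < N := ha.1
      rcases h : u r with _ | ⟨_ | _, _⟩ <;> simp [step, PMF.pure_map, h, mem_low _ _ hr]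
    | loop r =>
      have hr : r < N := ha.1
      rcases h : u r with _ | ⟨_, _⟩ <;> simp [step, PMF.pure_map, h, mem_low _ _ hr]

/-- One step of a program below `N` leads to programs below `N`. -/
theorem below_of_mem_support_step {N : ℕ} {D : PMF (List Bool)} {c c' : Config}
    (hc : ∀ a ∈ c.1, a.Below N) (h : c' ∈ (step D c).support) : ∀ a ∈ c'.1, a.Below N := by
  obtain ⟨k, s⟩ := c
  cases k with
  | nil =>
    simp only [step, PMF.support_pure, Set.mem_singleton_iff] at h
    subst h; simp
  | cons a k =>
    have ha := hc a (by simp)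
    have hk : ∀ a ∈ k, a.Below N := fun b hb => hc b (by simp at hb ⊢; exact Or.inr hb)
    cases a with
    | skip | push | pop =>
      simp only [step, PMF.support_pure, Set.mem_singleton_iff] at h
      subst h; exact hk
    | flip | draw =>
      simp only [step, PMF.mem_support_map_iff] at h
      obtain ⟨_, _, rfl⟩ := h
      exact hk
    | seq a b =>
      simp only [step, PMF.support_pure, Set.mem_singleton_iff] at h
      subst h
      simpa using ⟨ha.1, ha.2, hk⟩
    | branch r e z o =>
      simp only [step, PMF.support_pure, Set.mem_singleton_iff] at h
      subst h
      rcases s r with _ | ⟨_ | _, _⟩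
      · simpa using ⟨ha.2.1, hk⟩
      · simpa using ⟨ha.2.2.1, hk⟩
      · simpa using ⟨ha.2.2.2, hk⟩
    | loop r a =>
      simp only [step, PMF.support_pure, Set.mem_singleton_iff] at h
      subst h
      rcases s r with _ | ⟨_ , _⟩
      · simpa using hk
      · simpa using ⟨ha.2, ha, hk⟩

theorem run_mem {N : ℕ} (D : PMF (List Bool)) (l : List (List Bool)) (t : ℕ) {k : List Prog}
    (hk : ∀ a ∈ k, a.Below N) (u : Memory) :
    run D t (k, mem N u l) = (run D t (k, u)).map fun c => (c.1, mem N c.2 l) := by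
  induction t generalizing k u with
  | zero => simp [run, PMF.pure_map]
  | succ t ih =>
    simp only [run]
    rw [step_mem D l hk, PMF.bind_map, PMF.map_bind]
    exact PMF.bind_congr_support _ fun c hc => ih (below_of_mem_support_step hk hc) c.2

theorem Ends.mem {N : ℕ} {D : PMF (List Bool)} {a : Prog} {u : Memory} {t : ℕ} {μ : PMF Memory}
    (h : Ends D a u t μ) (ha : a.Below N) (l : List (List Bool)) :
    Ends D a (mem N u l) t (μ.map fun u' => Prog.mem N u' l) := by
  unfold Ends
  rw [run_mem D l t (by simpa using ha), h, PMF.map_comp, PMF.map_comp]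
  rfl

theorem Runs.mem {N : ℕ} {a : Prog} {u u' : Memory} {t : ℕ} (h : Runs a u t u') (ha : a.Below N)
    (l : List (List Bool)) : Runs a (mem N u l) t (Prog.mem N u' l) := fun D => by
  rw [run_mem D l t (by simpa using ha), h D, PMF.pure_map]

/-- One step lengthens a register by at most a bit or a sample, and `d + 1` bounds both. This
controls the length of a learnt description, and the cost of erasing what a black box leaves behind.
-/
theorem length_le_of_mem_support_run {D : PMF (List Bool)} {d : ℕ}
    (hD : ∀ x ∈ D.support, x.length ≤ d) (t : ℕ) {c c' : Config}
    (h : c' ∈ (run D t c).support) (r : ℕ) :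
    (c'.2 r).length ≤ (c.2 r).length + t * (d + 1) := by
  induction t generalizing c with
  | zero =>
    simp only [run, PMF.support_pure, Set.mem_singleton_iff] at h
    simp [h]
  | succ t ih =>
    simp only [run, PMF.mem_support_bind_iff] at h
    obtain ⟨b, hb, h⟩ := h
    have h1 := ih h
    suffices h2 : (b.2 r).length ≤ (c.2 r).length + (d + 1) by
      rw [Nat.succ_mul]; omega
    obtain ⟨k, s⟩ := c
    have upd : ∀ (r' : ℕ) (v : List Bool), v.length ≤ (s r').length + (d + 1) →
        (Function.update s r' v r).length ≤ (s r).length + (d + 1) := by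
      intro r' v hv
      by_cases hr : r = r'
      · subst hr; simpa using hv
      · simp [hr]
    cases k with
    | nil =>
      simp only [step, PMF.support_pure, Set.mem_singleton_iff] at hb
      subst hb; simp
    | cons a k =>
      cases a with
      | skip | seq =>
        simp only [step, PMF.support_pure, Set.mem_singleton_iff] at hb
        subst hb; simp
      | push =>
        simp only [step, PMF.support_pure, Set.mem_singleton_iff] at hb
        subst hb; exact upd _ _ (by simp)
      | pop =>
        simp only [step, PMF.support_pure, Set.mem_singleton_iff] at hb
        subst hb; exact upd _ _ (by simp; omega)
      | flip =>
        simp only [step, PMF.mem_support_map_iff] at hb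
        obtain ⟨_, _, rfl⟩ := hb
        exact upd _ _ (by simp)
      | draw =>
        simp only [step, PMF.mem_support_map_iff] at hb
        obtain ⟨x, hx, rfl⟩ := hb
        have := hD x hx
        exact upd _ _ (by simp; omega)
      | branch r' e z o =>
        simp only [step, PMF.support_pure, Set.mem_singleton_iff] at hb
        subst hb
        rcases s r' with _ | ⟨_ | _, _⟩ <;> simp
      | loop r' a =>
        simp only [step, PMF.support_pure, Set.mem_singleton_iff] at hb
        subst hb
        rcases s r' with _ | ⟨_, _⟩ <;> simp

theorem Ends.length_le {D : PMF (List Bool)} {d : ℕ} (hD : ∀ x ∈ D.support, x.length ≤ d)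
    {a : Prog} {s s' : Memory} {t : ℕ} {μ : PMF Memory} (h : Ends D a s t μ)
    (hs : s' ∈ μ.support) (r : ℕ) : (s' r).length ≤ (s r).length + t * (d + 1) :=
  length_le_of_mem_support_run hD t (h.mem_support hs) r

theorem Runs.length_le {a : Prog} {s s' : Memory} {t : ℕ} (h : Runs a s t s') (r : ℕ) :
    (s' r).length ≤ (s r).length + t := by
  have := (h.ends (PMF.pure [])).length_le (d := 0) (by simp) (s' := s') (by simp) r
  simpa using this

/-! ### Deterministic programs -/

/-- Without coins and draws the law `D` is never consulted, so one configuration serves for all `D`.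
It lets the evaluator, whose time bound is stated for `PMF.pure []`, be called while noisy parity
samples are available. -/
theorem Deterministic.exists_run {k : List Prog} (hk : ∀ a ∈ k, a.Deterministic) (s : Memory)
    (t : ℕ) : ∃ c : Config, ∀ D, run D t (k, s) = PMF.pure c := by
  induction t generalizing k s with
  | zero => exact ⟨_, fun D => rfl⟩
  | succ t ih =>
    suffices h : ∃ c : Config, (∀ a ∈ c.1, a.Deterministic) ∧ ∀ D, step D (k, s) = PMF.pure c by
      obtain ⟨⟨k', s'⟩, hk', hc⟩ := h
      obtain ⟨c, h⟩ := ih hk' s'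
      exact ⟨c, fun D => by simp [run, hc, h]⟩
    cases k with
    | nil => exact ⟨_, hk, fun D => rfl⟩
    | cons a k =>
      have ha := hk a (by simp)
      have hk' : ∀ a ∈ k, a.Deterministic := fun b hb => hk b (by simp at hb ⊢; exact Or.inr hb)
      cases a with
      | skip | push | pop => exact ⟨_, hk', fun D => rfl⟩
      | flip | draw => exact ha.elim
      | seq a b => exact ⟨_, by simpa using ⟨ha.1, ha.2, hk'⟩, fun D => rfl⟩
      | branch r e z o =>
        refine ⟨_, ?_, fun D => rfl⟩
        rcases s r with _ | ⟨_ | _, _⟩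
        · simpa using ⟨ha.1, hk'⟩
        · simpa using ⟨ha.2.1, hk'⟩
        · simpa using ⟨ha.2.2, hk'⟩
      | loop r a =>
        refine ⟨_, ?_, fun D => rfl⟩
        rcases s r with _ | ⟨_ , _⟩
        · simpa using hk'
        · have hl : (loop r a).Deterministic := ha
          simpa using ⟨ha, hl, hk'⟩

theorem Deterministic.exists_runs {D : PMF (List Bool)} {a : Prog} (ha : a.Deterministic)
    {s : Memory} {t : ℕ} (h : HaltsIn D a s t) : ∃ s', Runs a s t s' := by
  obtain ⟨⟨k, s'⟩, hc⟩ := Deterministic.exists_run (k := [a]) (by simpa using ha) s t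
  obtain rfl : k = [] := h (k, s') (by simp [hc])
  exact ⟨s', hc⟩

/-- A halted configuration no longer changes, so the final memory does not depend on the time
allowed. `Describes` gives no bound on its time; this identifies its result with that of the
polynomial-time run. -/
theorem Runs.eq_of_run_eq {D : PMF (List Bool)} {a : Prog} {s s' s'' : Memory} {t u : ℕ}
    (h : Runs a s t s') (h' : run D u ([a], s) = PMF.pure ([], s'')) : s'' = s' := by
  have hE : Ends D a s u (PMF.pure s'') := by rw [Ends, h', PMF.pure_map]
  have h1 := hE.mono (le_max_left u t)
  have h2 := (h.ends D).mono (le_max_right u t)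
  have e : (PMF.pure ([], s'') : PMF Config) = PMF.pure ([], s') := by
    have := Eq.trans (Eq.symm h1) h2
    simpa [PMF.pure_map] using this
  have hm : (([], s'') : Config) ∈ (PMF.pure (([], s') : Config)).support := by rw [← e]; simp
  simpa using hm

/-! ### Building blocks -/

theorem Runs.of_eq {a : Prog} {s s' s'' : Memory} {t : ℕ} (h : Runs a s t s') (e : s' = s'') :
    Runs a s t s'' := e ▸ h

/-- Put the bit `b` on top of each of the registers in `ts`. -/
def pushAll (ts : List ℕ) (b : Bool) : Prog := ts.foldr (fun t a => seq (push t b) a) skip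

/-- The memory after putting the bits `v` on top of each of the registers in `ts`. -/
def appendAll (ts : List ℕ) (v : List Bool) (s : Memory) : Memory :=
  ts.foldl (fun s t => Function.update s t (v ++ s t)) s

theorem appendAll_apply {ts : List ℕ} (h : ts.Nodup) (v : List Bool) (s : Memory) (j : ℕ) :
    appendAll ts v s j = if j ∈ ts then v ++ s j else s j := by
  induction ts generalizing s with
  | nil => simp [appendAll]
  | cons t ts ih =>
    have := ih h.of_cons (Function.update s t (v ++ s t))
    unfold appendAll at this ⊢
    rw [List.foldl_cons, this]
    have ht : t ∉ ts := (List.nodup_cons.1 h).1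
    by_cases hj : j = t
    · subst hj; simp [ht]
    · simp [hj]

theorem runs_pushAll (ts : List ℕ) (b : Bool) (s : Memory) :
    Runs (pushAll ts b) s (2 * ts.length + 1) (appendAll ts [b] s) := by
  induction ts generalizing s with
  | nil => exact runs_skip s
  | cons t ts ih => exact ((runs_push t b s).seq (ih _)).mono (by simp; omega)

/-- Empty register `r`, putting each of its bits on top of all registers in `ts`. -/
def transfer (r : ℕ) (ts : List ℕ) : Prog :=
  loop r (branch r skip (seq (pop r) (pushAll ts false)) (seq (pop r) (pushAll ts true)))

/-- A bit costs one step each for the loop test, the branch, the sequencing and the `pop`, and `2 *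
ts.length + 1` for the pushes: at most 11 when there are three targets. The order of the bits is
reversed, so a faithful copy takes two transfers. -/
theorem runs_transfer {r : ℕ} {ts : List ℕ} (h : (r :: ts).Nodup) (h3 : ts.length ≤ 3)
    (s : Memory) {B : ℕ} (hB : (s r).length ≤ B) :
    Runs (transfer r ts) s (11 * B + 1)
      (appendAll ts (s r).reverse (Function.update s r [])) := by
  have hr : r ∉ ts := (List.nodup_cons.1 h).1
  suffices H : ∀ l s, s r = l → Runs (transfer r ts) s (11 * l.length + 1)
      (appendAll ts l.reverse (Function.update s r [])) from
    (H _ s rfl).mono (by omega)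
  intro l
  induction l with
  | nil =>
    intro s hs
    refine (runs_loop_nil hs).of_eq ?_
    funext j
    rw [appendAll_apply h.of_cons, ← hs, Function.update_eq_self]
    simp [hs]
  | cons b l ih =>
    intro s hs
    have e : appendAll ts [b] (Function.update s r (s r).tail) r = l := by
      rw [appendAll_apply h.of_cons]; simp [hr, hs]
    have hbody := (runs_pop r s).seq (runs_pushAll ts b _)
    have key := Runs.loop_cons (r := r) (s := s)
      (a := branch r skip (seq (pop r) (pushAll ts false)) (seq (pop r) (pushAll ts true)))
      (by simp [hs]) (t := 2 * ts.length + 4)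
      (s' := appendAll ts [b] (Function.update s r (s r).tail)) (by
        cases b with
        | false => exact (Runs.branch_false hs hbody).mono (by omega)
        | true => exact (Runs.branch_true hs hbody).mono (by omega)) (ih _ e)
    refine (key.mono (by simp; omega)).of_eq ?_
    funext j
    simp only [appendAll_apply h.of_cons]
    by_cases hj : j = r
    · subst hj; simp [hr]
    · by_cases hjt : j ∈ ts <;> simp [hj, hjt, appendAll_apply h.of_cons]

/-- Empty register `r`. -/
def drain (r : ℕ) : Prog := loop r (pop r)

theorem runs_drain (r : ℕ) (s : Memory) {B : ℕ} (hB : (s r).length ≤ B) :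
    Runs (drain r) s (2 * B + 1) (Function.update s r []) := by
  suffices H : ∀ l s, s r = l → Runs (drain r) s (2 * l.length + 1) (Function.update s r []) from
    (H _ s rfl).mono (by omega)
  intro l
  induction l with
  | nil => exact fun s hs => (runs_loop_nil hs).of_eq (by rw [← hs, Function.update_eq_self])
  | cons b l ih =>
    intro s hs
    refine ((Runs.loop_cons (by simp [hs]) (runs_pop r s) (ih _ (by simp [hs]))).mono
      (by simp; omega)).of_eq (by simp)

/-- Empty the registers below `N`. -/
def clear : ℕ → Prog
  | 0 => skip
  | N + 1 => seq (clear N) (drain N)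

theorem runs_clear (N : ℕ) (s : Memory) {B : ℕ} (hB : ∀ r < N, (s r).length ≤ B) :
    Runs (clear N) s (N * (2 * B + 2) + 1) (fun r => if r < N then [] else s r) := by
  induction N with
  | zero => exact ((runs_skip s).mono (by omega)).of_eq (funext fun j => by simp)
  | succ N ih =>
    refine (((ih fun r hr => hB r (by omega)).seq
      (runs_drain N _ (B := B) (by simpa using hB N (by omega)))).mono
      (by have : (N + 1) * (2 * B + 2) = N * (2 * B + 2) + (2 * B + 2) := by ring
          omega)).of_eq ?_
    funext j
    by_cases hj : j = N
    · subst hj; simp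
    · have : j < N + 1 ↔ j < N := by omega
      simp [hj, this]

/-- The erased part is displayed as an `input` with three empty entries, so that the arguments of
the next call can be written there by `update_input`. -/
theorem runs_clear_mem (N : ℕ) (u : Memory) (l : List (List Bool)) {B : ℕ}
    (hB : ∀ r < N, (u r).length ≤ B) :
    Runs (clear N) (mem N u l) (N * (2 * B + 2) + 1) (mem N (input [[], [], []]) l) := by
  refine (runs_clear N _ (B := B) fun r hr => by rw [mem_low _ _ hr]; exact hB r hr).of_eq ?_
  funext j
  by_cases hj : j < N
  · rcases j with _ | _ | _ | j <;> simp [mem, hj, input]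
  · simp [mem, hj]

/-- Remove the top `c` bits of register `r`. -/
def popMany (r : ℕ) : ℕ → Prog
  | 0 => skip
  | c + 1 => seq (pop r) (popMany r c)

theorem runs_popMany (r c : ℕ) (s : Memory) :
    Runs (popMany r c) s (2 * c + 1) (Function.update s r ((s r).drop c)) := by
  induction c generalizing s with
  | zero => exact (runs_skip s).of_eq (by simp)
  | succ c ih =>
    exact (((runs_pop r s).seq (ih _)).mono (by omega)).of_eq (by simp)

/-- Put the bit `true` on top of register `r`, `c` times. -/
def pushMany (r : ℕ) : ℕ → Prog
  | 0 => skip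
  | c + 1 => seq (push r true) (pushMany r c)

theorem runs_pushMany (r c : ℕ) (s : Memory) :
    Runs (pushMany r c) s (2 * c + 1) (Function.update s r (unary c ++ s r)) := by
  induction c generalizing s with
  | zero => exact (runs_skip s).of_eq (by simp [unary])
  | succ c ih =>
    refine (((runs_push r true s).seq (ih _)).mono (by omega)).of_eq ?_
    have : unary c ++ true :: s r = unary (c + 1) ++ s r := by
      simp [unary, List.replicate_succ', List.append_assoc]
    simp [this]

/-- Empty register `r`, and put on top of register `o` the disjunction of its bits; register `f`
is auxiliary. -/
def anyBit (r f o : ℕ) : Prog :=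
  seq (loop r (seq (branch r skip skip (push f true)) (pop r)))
    (seq (branch f (push o false) skip (push o true)) (drain f))

theorem runs_anyBit {r f o : ℕ} (hrf : r ≠ f) (hro : r ≠ o) (hfo : f ≠ o) (s : Memory)
    (hf : s f = []) {B : ℕ} (hB : (s r).length ≤ B) :
    Runs (anyBit r f o) s (7 * B + 7)
      (Function.update (Function.update s r []) o ((s r).any id :: s o)) := by
  -- Register `f` collects one bit per `true` in `r`, so in the end it is empty exactly if the
  -- disjunction is false.
  have H : ∀ l s, s r = l →
      Runs (loop r (seq (branch r skip skip (push f true)) (pop r))) s (5 * l.length + 1)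
        (Function.update (Function.update s r []) f (unary (l.count true) ++ s f)) := by
    intro l
    induction l with
    | nil =>
      intro s hs
      refine (runs_loop_nil hs).of_eq ?_
      rw [← hs, Function.update_eq_self]
      simp [hs, unary]
    | cons b l ih =>
      intro s hs
      cases b with
      | false =>
        have h1 := (Runs.branch_false (e := skip) (o := push f true) hs (runs_skip s)).seq
          (runs_pop r s)
        refine ((Runs.loop_cons (by simp [hs]) h1 (ih _ (by simp [hs]))).mono
          (by simp; omega)).of_eq ?_
        simp [hrf.symm]
      | true =>
        have h1 := (Runs.branch_true (e := skip) (z := skip) hs (runs_push f true s)).seq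
          (runs_pop r _)
        refine ((Runs.loop_cons (by simp [hs]) h1 (ih _ (by simp [hs, hrf]))).mono
          (by simp; omega)).of_eq ?_
        funext j
        by_cases hj : j = f
        · subst hj
          simp [hrf.symm, unary, List.replicate_succ', List.append_assoc]
        · by_cases hjr : j = r
          · subst hjr; simp [hrf]
          · simp [hj, hjr]
  have h1 := H _ s rfl
  rw [hf, List.append_nil] at h1
  set s1 := Function.update (Function.update s r []) f (unary ((s r).count true)) with hs1
  have hs1f : s1 f = unary ((s r).count true) := by simp [hs1]
  have h2 : Runs (branch f (push o false) skip (push o true)) s1 2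
      (Function.update s1 o ((s r).any id :: s1 o)) := by
    rcases hc : (s r).count true with _ | c
    · have ha : (s r).any id = false := by
        rw [List.count_eq_zero] at hc
        simpa using fun h => hc h
      rw [ha]
      exact Runs.branch_nil (by simp [hs1f, hc, unary]) (runs_push o false s1)
    · have ha : (s r).any id = true := by
        have : 0 < (s r).count true := by omega
        rw [List.count_pos_iff] at this
        simpa using this
      rw [ha]
      exact Runs.branch_true (by rw [hs1f, hc, unary, List.replicate_succ]) (runs_push o true s1)
  have hcl : (s r).count true ≤ (s r).length := List.count_le_length
  have h3 := runs_drain f (Function.update s1 o ((s r).any id :: s1 o)) (B := (s r).length) (by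
    rw [Function.update_of_ne hfo, hs1f]; simpa [unary] using hcl)
  refine ((h1.seq (h2.seq h3)).mono (by omega)).of_eq ?_
  funext j
  by_cases hj : j = f
  · subst hj; simp [hrf.symm, hfo, hf]
  · by_cases hjo : j = o
    · subst hjo; simp [hs1, hj, hro.symm]
    · by_cases hjr : j = r
      · subst hjr; simp [hs1, hj, hjo]
      · simp [hs1, hj, hjo, hjr]

/-- Negate the top bit of register `r`. -/
def toggle (r : ℕ) : Prog :=
  branch r skip (seq (pop r) (push r true)) (seq (pop r) (push r false))

theorem runs_toggle {r : ℕ} {s : Memory} {b : Bool} {l : List Bool} (hs : s r = b :: l) :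
    Runs (toggle r) s 4 (Function.update s r ((!b) :: l)) := by
  cases b with
  | false =>
    exact (Runs.branch_false hs ((runs_pop r s).seq (runs_push r true _))).of_eq (by simp [hs])
  | true =>
    exact (Runs.branch_true hs ((runs_pop r s).seq (runs_push r false _))).of_eq (by simp [hs])

/-- Move the top bit of register `r` to register `t`. -/
def moveTop (r t : ℕ) : Prog :=
  branch r skip (seq (pop r) (push t false)) (seq (pop r) (push t true))

theorem runs_moveTop {r t : ℕ} (hrt : r ≠ t) {s : Memory} {b : Bool} {l : List Bool}
    (hs : s r = b :: l) :
    Runs (moveTop r t) s 4 (Function.update (Function.update s r l) t (b :: s t)) := by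
  cases b with
  | false =>
    exact (Runs.branch_false hs ((runs_pop r s).seq (runs_push t false _))).of_eq
      (by simp [hs, hrt.symm])
  | true =>
    exact (Runs.branch_true hs ((runs_pop r s).seq (runs_push t true _))).of_eq
      (by simp [hs, hrt.symm])

/-- Add the top bit of register `r` to the top bit of register `o`. -/
def xorTop (r o : ℕ) : Prog := branch r skip skip (toggle o)

theorem runs_xorTop {r o : ℕ} {s : Memory} {b c : Bool} {l k : List Bool}
    (hr : s r = b :: l) (ho : s o = c :: k) :
    Runs (xorTop r o) s 5 (Function.update s o (xor b c :: k)) := by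
  cases b with
  | false =>
    exact ((Runs.branch_false hr (runs_skip s)).mono (by omega)).of_eq
      (by rw [Bool.false_xor, ← ho, Function.update_eq_self])
  | true => exact (Runs.branch_true hr (runs_toggle ho)).of_eq (by simp)

/-! ### Canonical forms of memories -/

theorem mem_high_zero (N : ℕ) (u : Memory) (a : List Bool) (l : List (List Bool)) :
    mem N u (a :: l) N = a := mem_high N u (a :: l) 0

theorem update_mem_high_zero (N : ℕ) (u : Memory) (a : List Bool) (l : List (List Bool))
    (v : List Bool) : Function.update (mem N u (a :: l)) N v = mem N u (v :: l) :=
  update_mem_high N u (a :: l) (i := 0) (by simp) v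

theorem update_input {l : List (List Bool)} {i : ℕ} (h : i < l.length) (v : List Bool) :
    Function.update (input l) i v = input (l.set i v) := by
  funext j
  by_cases hj : j = i
  · subst hj; simp [input, h]
  · simp [input, hj, List.getD_eq_getElem?_getD, List.getElem?_set_ne (Ne.symm hj)]

theorem input_apply (l : List (List Bool)) (i : ℕ) : input l i = l.getD i [] := rfl

/-! ### One attempt at finding the hidden vector -/

/-- Ask the evaluator `E` for the bits of a probability, forget the last `c` of them and record in
register `N + 8` whether the number that is left is positive. The description is in register
`N + 2`, the sequence in registers `N + 3` (reversed) and `N + 4`, the precision in `N + 1`. -/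
def query (E : Prog) (N c : ℕ) : Prog :=
  seq (clear N) <|
  seq (transfer (N + 2) [N + 5]) <| seq (transfer (N + 5) [N + 2, 0]) <|
  seq (transfer (N + 4) [N + 5]) <| seq (transfer (N + 5) [N + 4, 1]) <|
  seq (transfer (N + 3) [N + 5, 1]) <| seq (transfer (N + 5) [N + 3]) <|
  seq (transfer (N + 1) [N + 5]) <| seq (transfer (N + 5) [N + 1, 2]) <|
  seq E <| seq (popMany 0 c) (anyBit 0 (N + 6) (N + 8))

/-- A bound for the running time of `query`. -/
def queryTime (N c B : ℕ) : ℕ := N * (4 * B + 2) + 200 * B + 2 * c + 100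

/-- The invariant is that registers from `N` on are restored, apart from the new answer on `N + 8`,
and that those below `N` stay of length at most `2 * B`, which pays for the `clear` of the next
query. -/
theorem runs_query {E : Prog} {N : ℕ} (hN : 3 ≤ N) (hE : E.Below N) (c : ℕ) {B m : ℕ}
    {w zl zr : List Bool} {ev : Memory}
    (hev : Runs E (input [w, zl.reverse ++ zr, unary m]) B ev) (hw : w.length ≤ B)
    (hz : zl.length + zr.length ≤ B) (hm : m ≤ B) {u : Memory}
    (hu : ∀ r < N, (u r).length ≤ 2 * B) (cnt base o : List Bool) :
    ∃ u' : Memory, (∀ r < N, (u' r).length ≤ 2 * B) ∧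
      Runs (query E N c) (mem N u [cnt, unary m, w, zl, zr, [], [], base, o]) (queryTime N c B)
        (mem N u' [cnt, unary m, w, zl, zr, [], [], base, ((ev 0).drop c).any id :: o]) := by
  have h0 : 0 < N := by omega
  have h1 : 1 < N := by omega
  have h2 : 2 < N := by omega
  -- Inputs of length at most `B`, and at most one more bit in each of the `B` steps of `E`.
  have hlen : ∀ r < N, (ev r).length ≤ 2 * B := by
    intro r _
    have := hev.length_le r
    have : (input [w, zl.reverse ++ zr, unary m] r).length ≤ B := by
      rcases r with _ | _ | _ | r
      · simpa [input] using hw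
      · simpa [input] using hz
      · simpa [input, unary] using hm
      · simp [input]
    omega
  refine ⟨Function.update ev 0 [], fun r hr => ?_, ?_⟩
  · by_cases h : r = 0
    · subst h; simp
    · simpa [h] using hlen r hr
  have e1 := runs_clear_mem N u [cnt, unary m, w, zl, zr, [], [], base, o] (B := 2 * B) hu
  have e2 : Runs (transfer (N + 2) [N + 5])
      (mem N (input [[], [], []]) [cnt, unary m, w, zl, zr, [], [], base, o]) (11 * B + 1)
      (mem N (input [[], [], []]) [cnt, unary m, [], zl, zr, w.reverse, [], base, o]) :=
    (runs_transfer (by simp) (by simp) _ (by simpa [mem_high] using hw)).of_eq (by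
      simp [appendAll, mem_high, update_mem_high])
  have e3 : Runs (transfer (N + 5) [N + 2, 0])
      (mem N (input [[], [], []]) [cnt, unary m, [], zl, zr, w.reverse, [], base, o]) (11 * B + 1)
      (mem N (input [w, [], []]) [cnt, unary m, w, zl, zr, [], [], base, o]) :=
    (runs_transfer (by simp) (by simp) _ (by simpa [mem_high] using hw)).of_eq (by
      simp [appendAll, mem_high, update_mem_high, mem_low, update_mem_low, update_input,
        input_apply, h0])
  have e4 : Runs (transfer (N + 4) [N + 5])
      (mem N (input [w, [], []]) [cnt, unary m, w, zl, zr, [], [], base, o]) (11 * B + 1)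
      (mem N (input [w, [], []]) [cnt, unary m, w, zl, [], zr.reverse, [], base, o]) :=
    (runs_transfer (by simp) (by simp) _ (by simp [mem_high]; omega)).of_eq (by
      simp [appendAll, mem_high, update_mem_high])
  have e5 : Runs (transfer (N + 5) [N + 4, 1])
      (mem N (input [w, [], []]) [cnt, unary m, w, zl, [], zr.reverse, [], base, o]) (11 * B + 1)
      (mem N (input [w, zr, []]) [cnt, unary m, w, zl, zr, [], [], base, o]) :=
    (runs_transfer (by simp) (by simp) _ (by simp [mem_high]; omega)).of_eq (by
      simp [appendAll, mem_high, update_mem_high, mem_low, update_mem_low, update_input,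
        input_apply, h1])
  -- The left part is stored reversed, so a single transfer puts it in the right order on top of
  -- `zr` in register 1.
  have e6 : Runs (transfer (N + 3) [N + 5, 1])
      (mem N (input [w, zr, []]) [cnt, unary m, w, zl, zr, [], [], base, o]) (11 * B + 1)
      (mem N (input [w, zl.reverse ++ zr, []])
        [cnt, unary m, w, [], zr, zl.reverse, [], base, o]) :=
    (runs_transfer (by simp) (by simp) _ (by simp [mem_high]; omega)).of_eq (by
      simp [appendAll, mem_high, update_mem_high, mem_low, update_mem_low, update_input,
        input_apply, h1])
  have e7 : Runs (transfer (N + 5) [N + 3])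
      (mem N (input [w, zl.reverse ++ zr, []])
        [cnt, unary m, w, [], zr, zl.reverse, [], base, o]) (11 * B + 1)
      (mem N (input [w, zl.reverse ++ zr, []])
        [cnt, unary m, w, zl, zr, [], [], base, o]) :=
    (runs_transfer (by simp) (by simp) _ (by simp [mem_high]; omega)).of_eq (by
      simp [appendAll, mem_high, update_mem_high])
  have e8 : Runs (transfer (N + 1) [N + 5])
      (mem N (input [w, zl.reverse ++ zr, []])
        [cnt, unary m, w, zl, zr, [], [], base, o]) (11 * B + 1)
      (mem N (input [w, zl.reverse ++ zr, []])
        [cnt, [], w, zl, zr, unary m, [], base, o]) :=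
    (runs_transfer (by simp) (by simp) _ (by simpa [mem_high, unary] using hm)).of_eq (by
      simp [appendAll, mem_high, update_mem_high, unary])
  have e9 : Runs (transfer (N + 5) [N + 1, 2])
      (mem N (input [w, zl.reverse ++ zr, []])
        [cnt, [], w, zl, zr, unary m, [], base, o]) (11 * B + 1)
      (mem N (input [w, zl.reverse ++ zr, unary m])
        [cnt, unary m, w, zl, zr, [], [], base, o]) :=
    (runs_transfer (by simp; omega) (by simp) _ (by simpa [mem_high, unary] using hm)).of_eq (by
      simp [appendAll, mem_high, update_mem_high, mem_low, update_mem_low, update_input,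
        input_apply, h2, unary])
  have e10 := hev.mem hE [cnt, unary m, w, zl, zr, [], [], base, o]
  have e11 := (runs_popMany 0 c (mem N ev [cnt, unary m, w, zl, zr, [], [], base, o])).of_eq
    (s'' := mem N (Function.update ev 0 ((ev 0).drop c))
      [cnt, unary m, w, zl, zr, [], [], base, o]) (by simp [mem_low, update_mem_low, h0])
  have e12 := (runs_anyBit (r := 0) (f := N + 6) (o := N + 8) (by simp) (by simp) (by simp)
    (mem N (Function.update ev 0 ((ev 0).drop c))
      [cnt, unary m, w, zl, zr, [], [], base, o]) (by simp [mem_high]) (B := 2 * B) (by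
        have := hlen 0 h0
        simp [mem_low, h0]; omega)).of_eq
    (s'' := mem N (Function.update ev 0 [])
      [cnt, unary m, w, zl, zr, [], [], base, ((ev 0).drop c).any id :: o]) (by
        simp [mem_low, update_mem_low, mem_high, update_mem_high, h0])
  refine Runs.mono (e1.seq <| e2.seq <| e3.seq <| e4.seq <| e5.seq <| e6.seq <| e7.seq <| e8.seq <|
    e9.seq <| e10.seq <| e11.seq e12) ?_
  have : N * (2 * (2 * B) + 2) = N * (4 * B + 2) := by ring
  unfold queryTime
  omega

/-- The guesses for the bits of the hidden vector when the parity of `x` is guessed to be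
`g (x ++ [true])`: the sequence is `zl.reverse ++ zr`, and the guesses for the positions of `zr`
are listed. -/
def guesses (g : List Bool → Bool) (base : Bool) : List Bool → List Bool → List Bool
  | _, [] => []
  | zl, b :: zr =>
    xor base (g (zl.reverse ++ ((!b) :: zr ++ [true]))) :: guesses g base (b :: zl) zr

/-- Guess one bit of the hidden vector. -/
def guessBit (E : Prog) (N c : ℕ) : Prog :=
  seq (pop N) <| seq (toggle (N + 4)) <| seq (query E N c) <| seq (toggle (N + 4)) <|
    seq (xorTop (N + 7) (N + 8)) (moveTop (N + 4) (N + 3))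

/-- The bit under consideration is negated only during the query; then it is restored and moved to
the left part, so the sequence itself is preserved. -/
theorem runs_guessBit {E : Prog} {N : ℕ} (hN : 3 ≤ N) (hE : E.Below N) (c : ℕ) {B m n : ℕ}
    {w zl zr : List Bool} {b base : Bool} {ev : Memory}
    (hev : Runs E (input [w, zl.reverse ++ ((!b) :: zr), unary m]) B ev) (hw : w.length ≤ B)
    (hz : zl.length + zr.length + 1 ≤ B) (hm : m ≤ B) {u : Memory}
    (hu : ∀ r < N, (u r).length ≤ 2 * B) (o : List Bool) :
    ∃ u' : Memory, (∀ r < N, (u' r).length ≤ 2 * B) ∧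
      Runs (guessBit E N c)
        (mem N u [unary (n + 1), unary m, w, zl, b :: zr, [], [], [base], o])
        (queryTime N c B + 30)
        (mem N u' [unary n, unary m, w, b :: zl, zr, [], [], [base],
          xor base (((ev 0).drop c).any id) :: o]) := by
  obtain ⟨u', hu', e3⟩ := runs_query hN hE c hev hw (by simp; omega) hm hu (unary n) [base] o
  refine ⟨u', hu', ?_⟩
  set a := ((ev 0).drop c).any id
  have e1 := (runs_pop N (mem N u [unary (n + 1), unary m, w, zl, b :: zr, [], [], [base], o])).of_eq
    (s'' := mem N u [unary n, unary m, w, zl, b :: zr, [], [], [base], o])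
    (by simp [mem_high_zero, update_mem_high_zero, unary])
  have e2 := (runs_toggle (r := N + 4)
    (s := mem N u [unary n, unary m, w, zl, b :: zr, [], [], [base], o]) (b := b) (l := zr)
      (by simp [mem_high])).of_eq
    (s'' := mem N u [unary n, unary m, w, zl, (!b) :: zr, [], [], [base], o])
    (by simp [update_mem_high])
  have e4 := (runs_toggle (r := N + 4)
    (s := mem N u' [unary n, unary m, w, zl, (!b) :: zr, [], [], [base], a :: o]) (b := !b)
      (l := zr) (by simp [mem_high])).of_eq
    (s'' := mem N u' [unary n, unary m, w, zl, b :: zr, [], [], [base], a :: o])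
    (by simp [update_mem_high])
  have e5 := (runs_xorTop (r := N + 7) (o := N + 8)
    (s := mem N u' [unary n, unary m, w, zl, b :: zr, [], [], [base], a :: o]) (b := base)
      (c := a) (l := []) (k := o) (by simp [mem_high]) (by simp [mem_high])).of_eq
    (s'' := mem N u' [unary n, unary m, w, zl, b :: zr, [], [], [base], xor base a :: o])
    (by simp [update_mem_high])
  have e6 := (runs_moveTop (r := N + 4) (t := N + 3) (by simp)
    (s := mem N u' [unary n, unary m, w, zl, b :: zr, [], [], [base], xor base a :: o]) (b := b)
      (l := zr) (by simp [mem_high])).of_eq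
    (s'' := mem N u' [unary n, unary m, w, b :: zl, zr, [], [], [base], xor base a :: o])
    (by simp [mem_high, update_mem_high])
  exact (e1.seq <| e2.seq <| e3.seq <| e4.seq <| e5.seq e6).mono (by omega)

/-- The unary counter in register `N` counts the bits of `zr` only, so the loop stops before the
final `true`, which stands for the label and is never negated. -/
theorem runs_guessBits {E : Prog} {N : ℕ} (hN : 3 ≤ N) (hE : E.Below N) (c : ℕ) {B m : ℕ}
    {w : List Bool} {g : List Bool → Bool} {ℓ : ℕ}
    (hg : ∀ x : List Bool, x.length = ℓ + 1 →
      ∃ ev, Runs E (input [w, x, unary m]) B ev ∧ ((ev 0).drop c).any id = g x)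
    (hw : w.length ≤ B) (hℓ : ℓ + 1 ≤ B) (hm : m ≤ B) (base : Bool) (zr : List Bool) :
    ∀ (zl : List Bool) (u : Memory) (o : List Bool), zl.length + zr.length = ℓ →
      (∀ r < N, (u r).length ≤ 2 * B) →
      ∃ (u' : Memory) (zl' : List Bool), (∀ r < N, (u' r).length ≤ 2 * B) ∧
        Runs (loop N (guessBit E N c))
          (mem N u [unary zr.length, unary m, w, zl, zr ++ [true], [], [], [base], o])
          (zr.length * (queryTime N c B + 31) + 1)
          (mem N u' [[], unary m, w, zl', [true], [], [], [base],
            (guesses g base zl zr).reverse ++ o]) := by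
  induction zr with
  | nil =>
    intro zl u o _ hu
    exact ⟨u, zl, hu, (runs_loop_nil (by simp [mem_high_zero, unary])).mono (by simp)⟩
  | cons b zr ih =>
    intro zl u o hz hu
    obtain ⟨ev, hev, hgev⟩ := hg (zl.reverse ++ ((!b) :: zr ++ [true])) (by simp at hz ⊢; omega)
    obtain ⟨u₁, hu₁, e1⟩ := runs_guessBit hN hE c (n := zr.length) (base := base)
      (b := b) (zr := zr ++ [true]) (by simpa using hev) hw (by simp at hz ⊢; omega) hm hu o
    rw [hgev] at e1
    obtain ⟨u', zl', hu', e2⟩ := ih (b :: zl) u₁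
      (xor base (g (zl.reverse ++ ((!b) :: zr ++ [true]))) :: o) (by simp at hz ⊢; omega) hu₁
    refine ⟨u', zl', hu', ((Runs.loop_cons ?_ e1 e2).mono ?_).of_eq ?_⟩
    · simp [mem_high_zero, unary, List.replicate_succ]
    · have : (zr.length + 1) * (queryTime N c B + 31) =
          zr.length * (queryTime N c B + 31) + (queryTime N c B + 31) := by ring
      simp only [List.length_cons]
      omega
    · simp [guesses]

/-- Find the hidden vector, using the evaluator `E`, from a description in register `0`, a vector
and one more bit in register `N + 4`, its length in register `N`, and the precision in `N + 1`. -/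
def decode (E : Prog) (N c : ℕ) : Prog :=
  seq (transfer 0 [N + 5]) <| seq (transfer (N + 5) [N + 2]) <|
  seq (transfer (N + 4) [N + 3]) <| seq (pop (N + 3)) <| seq (push (N + 3) true) <|
  seq (transfer (N + 3) [N + 4]) <|
  seq (query E N c) <| seq (transfer (N + 8) [N + 7]) <|
  seq (loop N (guessBit E N c)) <|
  seq (clear N) (transfer (N + 8) [0])

/-- A bound for the running time of `decode`. -/
def decodeTime (N c B : ℕ) : ℕ :=
  B * (queryTime N c B + 31) + queryTime N c B + N * (4 * B + 2) + 100 * B + 100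

theorem runs_decode {E : Prog} {N : ℕ} (hN : 3 ≤ N) (hE : E.Below N) (c : ℕ) {B m : ℕ}
    {u : Memory} {g : List Bool → Bool} {z : List Bool}
    (hg : ∀ x : List Bool, x.length = z.length + 1 →
      ∃ ev, Runs E (input [u 0, x, unary m]) B ev ∧ ((ev 0).drop c).any id = g x)
    (hB : z.length + 1 ≤ B) (hm : m ≤ B) (hu : ∀ r < N, (u r).length ≤ B) (b : Bool) :
    ∃ s : Memory, s 0 = guesses g (g (z ++ [true])) [] z ∧
      Runs (decode E N c)
        (mem N u [unary z.length, unary m, [], [], z ++ [b], [], [], [], []]) (decodeTime N c B)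
        s := by
  have h0 : 0 < N := by omega
  have hw := hu 0 h0
  set w := u 0 with hw0
  have e1 := (runs_transfer (r := 0) (ts := [N + 5]) (by simp) (by simp)
    (mem N u [unary z.length, unary m, [], [], z ++ [b], [], [], [], []]) (B := B)
    (by simpa [mem_low, h0, ← hw0] using hw)).of_eq
    (s'' := mem N (Function.update u 0 [])
      [unary z.length, unary m, [], [], z ++ [b], w.reverse, [], [], []])
    (by simp [appendAll, mem_low, update_mem_low, mem_high, update_mem_high, h0, ← hw0])
  set u₁ := Function.update u 0 [] with hu₁
  have hu₁' : ∀ r < N, (u₁ r).length ≤ 2 * B := by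
    intro r hr
    by_cases h : r = 0
    · subst h; simp [hu₁]
    · have := hu r hr
      simp [hu₁, h]; omega
  have e2 := (runs_transfer (r := N + 5) (ts := [N + 2]) (by simp) (by simp)
    (mem N u₁ [unary z.length, unary m, [], [], z ++ [b], w.reverse, [], [], []]) (B := B)
    (by simpa [mem_high] using hw)).of_eq
    (s'' := mem N u₁ [unary z.length, unary m, w, [], z ++ [b], [], [], [], []])
    (by simp [appendAll, mem_high, update_mem_high])
  have e3 := (runs_transfer (r := N + 4) (ts := [N + 3]) (by simp) (by simp)
    (mem N u₁ [unary z.length, unary m, w, [], z ++ [b], [], [], [], []]) (B := B)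
    (by simpa [mem_high] using hB)).of_eq
    (s'' := mem N u₁ [unary z.length, unary m, w, b :: z.reverse, [], [], [], [], []])
    (by simp [appendAll, mem_high, update_mem_high])
  -- The noisy label is discarded and replaced by `true`: only probabilities of sequences ending in
  -- 1 are asked for.
  have e4 := (runs_pop (N + 3)
    (mem N u₁ [unary z.length, unary m, w, b :: z.reverse, [], [], [], [], []])).of_eq
    (s'' := mem N u₁ [unary z.length, unary m, w, z.reverse, [], [], [], [], []])
    (by simp [mem_high, update_mem_high])
  have e5 := (runs_push (N + 3) true
    (mem N u₁ [unary z.length, unary m, w, z.reverse, [], [], [], [], []])).of_eq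
    (s'' := mem N u₁ [unary z.length, unary m, w, true :: z.reverse, [], [], [], [], []])
    (by simp [mem_high, update_mem_high])
  have e6 := (runs_transfer (r := N + 3) (ts := [N + 4]) (by simp) (by simp)
    (mem N u₁ [unary z.length, unary m, w, true :: z.reverse, [], [], [], [], []]) (B := B)
    (by simpa [mem_high] using hB)).of_eq
    (s'' := mem N u₁ [unary z.length, unary m, w, [], z ++ [true], [], [], [], []])
    (by simp [appendAll, mem_high, update_mem_high])
  obtain ⟨ev, hev, hgev⟩ := hg (z ++ [true]) (by simp)
  obtain ⟨u₂, hu₂, e7⟩ := runs_query hN hE c (zl := []) (zr := z ++ [true]) (by simpa using hev) hw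
    (by simpa using hB) hm hu₁' (unary z.length) [] []
  rw [hgev] at e7
  have e8 := (runs_transfer (r := N + 8) (ts := [N + 7]) (by simp) (by simp)
    (mem N u₂ [unary z.length, unary m, w, [], z ++ [true], [], [], [], [g (z ++ [true])]])
    (B := B) (by simp [mem_high]; omega)).of_eq
    (s'' := mem N u₂ [unary z.length, unary m, w, [], z ++ [true], [], [], [g (z ++ [true])], []])
    (by simp [appendAll, mem_high, update_mem_high])
  obtain ⟨u₃, zl', hu₃, e9⟩ := runs_guessBits hN hE c (ℓ := z.length) hg hw hB hm
    (g (z ++ [true])) z [] u₂ [] (by simp) hu₂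
  rw [List.append_nil] at e9
  set v := guesses g (g (z ++ [true])) [] z with hv
  have hvl : v.length = z.length := by
    have : ∀ (a : Bool) (zl zr : List Bool), (guesses g a zl zr).length = zr.length := by
      intro a zl zr
      induction zr generalizing zl with
      | nil => rfl
      | cons b zr ih => simp [guesses, ih]
    exact this _ _ _
  have e10 := runs_clear_mem N u₃ [[], unary m, w, zl', [true], [], [], [g (z ++ [true])],
    v.reverse] (B := 2 * B) hu₃
  -- The guesses were stacked in reverse; this last transfer puts them in order.
  have e11 := runs_transfer (r := N + 8) (ts := [0]) (by simp) (by simp)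
    (mem N (input [[], [], []]) [[], unary m, w, zl', [true], [], [], [g (z ++ [true])],
    v.reverse]) (B := B) (by simp [mem_high]; omega)
  refine ⟨_, ?_, Runs.mono (e1.seq <| e2.seq <| e3.seq <| e4.seq <| e5.seq <| e6.seq <| e7.seq <|
    e8.seq <| e9.seq <| e10.seq e11) ?_⟩
  · simp [appendAll, mem_low, mem_high, update_mem_high, h0, input_apply]
  · have : N * (2 * (2 * B) + 2) = N * (4 * B + 2) := by ring
    have : z.length * (queryTime N c B + 31) ≤ B * (queryTime N c B + 31) :=
      Nat.mul_le_mul_right _ (by omega)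
    unfold decodeTime
    omega

/-- Learn a distribution with `L`, draw one more sample to obtain a random vector, and find the
hidden vector with `decode`. -/
def attempt (L E : Prog) (N c : ℕ) : Prog :=
  seq (transfer 0 [N, N + 1, N + 5]) <| seq (transfer (N + 5) [0]) <| seq (push 0 true) <|
  seq (pushMany 1 2) <| seq (pushMany 2 2) <| seq (pushMany (N + 1) (c + 1)) <|
  seq L <| seq (draw (N + 4)) (decode E N c)

/-- A bound for the running time of `attempt`. -/
def attemptTime (N c B t : ℕ) : ℕ := decodeTime N c B + t + 100 * B + 2 * c + 100

/-- Lets the frame rule apply from the start: the initial memory already has blank scratch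
registers. -/
theorem input_eq_mem {N : ℕ} (v : List Bool) {l : List (List Bool)}
    (hl : ∀ v ∈ l, v = []) (hN : 0 < N) : input [v] = mem N (input [v, [], []]) l := by
  funext j
  have h : l.getD (j - N) [] = [] := by
    rw [List.getD_eq_getElem?_getD]
    rcases h : l[j - N]? with _ | a
    · rfl
    · exact hl a (List.mem_of_getElem? h)
  rcases j with _ | _ | _ | j <;> simp_all [mem, input]

/-- The extra sample is drawn after `L` has halted, hence is independent of the description `w`;
this is the nested `bind`. The evaluator is controlled only for `w` of the length that `L` can
produce in `t` steps with samples of length `n + 1`. -/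
theorem outputs_attempt {L E : Prog} {N : ℕ} (hN : 3 ≤ N) (hL : L.Below N) (hE : E.Below N)
    (c : ℕ) {n B t : ℕ} {D : PMF (List Bool)} (hD : ∀ x ∈ D.support, x.length = n + 1)
    {ν : PMF (List Bool)} (hLν : Outputs D L (input [unary (n + 1), unary 2, unary 2]) t ν)
    {g : List Bool → List Bool → Bool}
    (hg : ∀ w x : List Bool, w.length ≤ n + 3 + t * (n + 2) → x.length = n + 1 →
      ∃ ev, Runs E (input [w, x, unary (n + 1 + c)]) B ev ∧ ((ev 0).drop c).any id = g w x)
    (hB : n + 3 + t * (n + 2) ≤ B) (hm : n + 1 + c ≤ B) :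
    Outputs D (attempt L E N c) (input [unary n]) (attemptTime N c B t)
      (ν.bind fun w => D.map fun x =>
        guesses (g w) (g w (x.dropLast ++ [true])) [] x.dropLast) := by
  have h0 : 0 < N := by omega
  have h1 : 1 < N := by omega
  have h2 : 2 < N := by omega
  have hnB : n ≤ B := by omega
  -- Three copies of `1ⁿ`: the loop counter, the start of the precision, and one to restore register
  -- 0.
  have e1 := (runs_transfer (r := 0) (ts := [N, N + 1, N + 5]) (by simp; omega) (by simp)
    (mem N (input [unary n, [], []]) [[], [], [], [], [], [], [], [], []]) (B := B)
    (by simpa [mem_low, h0, input_apply, unary] using hnB)).of_eq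
    (s'' := mem N (input [[], [], []]) [unary n, unary n, [], [], [], unary n, [], [], []])
    (by simp [appendAll, mem_low, update_mem_low, mem_high, update_mem_high, h0, input_apply,
      update_input, mem_high_zero, update_mem_high_zero, unary])
  have e2 := (runs_transfer (r := N + 5) (ts := [0]) (by simp) (by simp)
    (mem N (input [[], [], []]) [unary n, unary n, [], [], [], unary n, [], [], []]) (B := B)
    (by simpa [mem_high, unary] using hnB)).of_eq
    (s'' := mem N (input [unary n, [], []]) [unary n, unary n, [], [], [], [], [], [], []])
    (by simp [appendAll, mem_low, update_mem_low, mem_high, update_mem_high, h0, input_apply,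
      update_input, unary])
  have e3 := (runs_push 0 true
    (mem N (input [unary n, [], []]) [unary n, unary n, [], [], [], [], [], [], []])).of_eq
    (s'' := mem N (input [unary (n + 1), [], []]) [unary n, unary n, [], [], [], [], [], [], []])
    (by simp [mem_low, update_mem_low, h0, input_apply, update_input, unary,
      List.replicate_succ])
  have e4 := (runs_pushMany 1 2
    (mem N (input [unary (n + 1), [], []]) [unary n, unary n, [], [], [], [], [], [], []])).of_eq
    (s'' := mem N (input [unary (n + 1), unary 2, []])
      [unary n, unary n, [], [], [], [], [], [], []])
    (by simp [mem_low, update_mem_low, h1, input_apply, update_input])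
  have e5 := (runs_pushMany 2 2
    (mem N (input [unary (n + 1), unary 2, []])
      [unary n, unary n, [], [], [], [], [], [], []])).of_eq
    (s'' := mem N (input [unary (n + 1), unary 2, unary 2])
      [unary n, unary n, [], [], [], [], [], [], []])
    (by simp [mem_low, update_mem_low, h2, input_apply, update_input])
  -- The precision is `n + 1 + c`: masses are of order `2⁻ⁿ`, and `c + 1` further bits resolve the
  -- gap.
  have hcn : unary (c + 1) ++ unary n = unary (n + 1 + c) := by
    rw [unary, unary, List.replicate_append_replicate, unary]
    congr 1; omega
  have e6 := (runs_pushMany (N + 1) (c + 1)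
    (mem N (input [unary (n + 1), unary 2, unary 2])
      [unary n, unary n, [], [], [], [], [], [], []])).of_eq
    (s'' := mem N (input [unary (n + 1), unary 2, unary 2])
      [unary n, unary (n + 1 + c), [], [], [], [], [], [], []])
    (by simp [mem_high, update_mem_high, hcn])
  obtain ⟨μ, hμ, rfl⟩ := hLν.ends
  have e7 := hμ.mem hL [unary n, unary (n + 1 + c), [], [], [], [], [], [], []]
  have key := e7.seq_outputs (b := seq (draw (N + 4)) (decode E N c))
    (u := 1 + decodeTime N c B + 1)
    (κ := fun s => D.map fun x => guesses (g (s 0)) (g (s 0) (x.dropLast ++ [true])) [] x.dropLast)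
    (by
      intro s hs
      rw [PMF.mem_support_map_iff] at hs
      obtain ⟨u, hu, rfl⟩ := hs
      have hul : ∀ r < N, (u r).length ≤ n + 3 + t * (n + 2) := by
        intro r _
        have := hμ.length_le (fun x hx => (hD x hx).le) hu r
        have h3 : (input [unary (n + 1), unary 2, unary 2] r).length ≤ n + 3 := by
          rcases r with _ | _ | _ | r <;> simp [input, unary]
        have : t * (n + 1 + 1) = t * (n + 2) := rfl
        omega
      have hdr := ends_draw D (N + 4)
        (mem N u [unary n, unary (n + 1 + c), [], [], [], [], [], [], []])
      have := hdr.seq_outputs (b := decode E N c) (u := decodeTime N c B)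
        (κ := fun s => PMF.pure (guesses (g (s 0)) (g (s 0) ((s (N + 4)).dropLast ++ [true])) []
          (s (N + 4)).dropLast)) (by
          intro s hs
          rw [PMF.mem_support_map_iff] at hs
          obtain ⟨x, hx, rfl⟩ := hs
          have hxl := hD x hx
          have hxne : x ≠ [] := by rintro rfl; simp at hxl
          obtain ⟨z, b, rfl⟩ : ∃ z b, x = z ++ [b] :=
            ⟨x.dropLast, x.getLast hxne, (List.dropLast_append_getLast hxne).symm⟩
          obtain rfl : z.length = n := by simpa using hxl
          obtain ⟨s', hs', hrun⟩ := runs_decode hN hE c (u := u) (z := z) (B := B)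
            (g := g (u 0)) (m := z.length + 1 + c)
            (fun x hx => hg (u 0) x (hul 0 h0) hx) (by omega) hm
            (fun r hr => (hul r hr).trans hB) b
          have hout := (hrun.ends D).outputs
          rw [PMF.pure_map, hs'] at hout
          simpa [update_mem_high, mem_low, mem_high, h0] using hout)
      rw [PMF.bind_map] at this
      simpa [mem_low, mem_high, update_mem_high, h0, Function.comp_def, PMF.map] using this)
  rw [PMF.bind_map] at key ⊢
  have key2 := e1.seq_outputs <| e2.seq_outputs <| e3.seq_outputs <| e4.seq_outputs <|
    e5.seq_outputs <| e6.seq_outputs key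
  rw [← input_eq_mem (unary n) (by simp) h0] at key2
  have hfin := key2.mono (u := attemptTime N c B t) (by unfold attemptTime; omega)
  simpa [Function.comp_def, mem_low, h0, attempt] using hfin

/-! ### Majority of three attempts -/

/-- The majority of three bits. -/
def maj (a b c : Bool) : Bool := (a && b) || (a && c) || (b && c)

/-- The majority of the top bits of the registers `r₁`, `r₂` and `r₃`, which are removed, is put
on top of register `o`. -/
def vote (r₁ r₂ r₃ o : ℕ) : Prog :=
  seq
    (branch r₁ skip
      (branch r₂ skip (push o false) (branch r₃ skip (push o false) (push o true)))
      (branch r₂ skip (branch r₃ skip (push o false) (push o true)) (push o true)))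
    (seq (pop r₁) (seq (pop r₂) (pop r₃)))

theorem runs_vote {K : ℕ} (hK : 0 < K) (u : Memory) (l₁ l₂ l₃ l₄ l₅ l₆ : List Bool)
    (a b c : Bool) :
    Runs (vote (K + 3) (K + 4) (K + 5) 0) (mem K u [l₁, l₂, l₃, a :: l₄, b :: l₅, c :: l₆]) 10
      (mem K (Function.update u 0 (maj a b c :: u 0)) [l₁, l₂, l₃, l₄, l₅, l₆]) := by
  set s := mem K u [l₁, l₂, l₃, a :: l₄, b :: l₅, c :: l₆] with hs
  have h1 : s (K + 3) = a :: l₄ := by simp [hs, mem_high]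
  have h2 : s (K + 4) = b :: l₅ := by simp [hs, mem_high]
  have h3 : s (K + 5) = c :: l₆ := by simp [hs, mem_high]
  have hv : Runs (branch (K + 3) skip
      (branch (K + 4) skip (push 0 false) (branch (K + 5) skip (push 0 false) (push 0 true)))
      (branch (K + 4) skip (branch (K + 5) skip (push 0 false) (push 0 true)) (push 0 true))) s 4
      (Function.update s 0 (maj a b c :: s 0)) := by
    cases a <;> cases b
    · exact ((Runs.branch_false h1 (Runs.branch_false h2 (runs_push 0 false s)))).mono
        (by omega)
    · refine Runs.branch_false h1 (Runs.branch_true h2 ?_)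
      cases c
      · exact Runs.branch_false h3 (runs_push 0 false s)
      · exact Runs.branch_true h3 (runs_push 0 true s)
    · refine Runs.branch_true h1 (Runs.branch_false h2 ?_)
      cases c
      · exact Runs.branch_false h3 (runs_push 0 false s)
      · exact Runs.branch_true h3 (runs_push 0 true s)
    · exact (Runs.branch_true h1 (Runs.branch_true h2 (runs_push 0 true s))).mono (by omega)
  refine ((hv.seq ((runs_pop _ _).seq ((runs_pop _ _).seq (runs_pop _ _))))).of_eq ?_
  simp [hs, mem_low, update_mem_low, mem_high, update_mem_high, hK]

/-- The saved outputs are reversed, so their tops are the last coordinates; pushing the majorities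
onto register 0 restores the order. Hence the induction peels off the last coordinate. -/
theorem runs_votes {K : ℕ} (hK : 0 < K) {n : ℕ} (x y z : Fin n → Bool) (u : Memory)
    (l₁ l₂ l₃ : List Bool) :
    Runs (loop (K + 3) (vote (K + 3) (K + 4) (K + 5) 0))
      (mem K u [l₁, l₂, l₃, (List.ofFn x).reverse, (List.ofFn y).reverse, (List.ofFn z).reverse])
      (11 * n + 1)
      (mem K (Function.update u 0 ((List.ofFn fun i => maj (x i) (y i) (z i)) ++ u 0))
        [l₁, l₂, l₃, [], [], []]) := by
  induction n generalizing u with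
  | zero => exact (runs_loop_nil (by simp [mem_high])).of_eq (by simp)
  | succ n ih =>
    simp only [List.ofFn_succ', List.concat_eq_append, List.reverse_append, List.reverse_singleton,
      List.singleton_append]
    refine ((Runs.loop_cons (by simp [mem_high]) (runs_vote hK u l₁ l₂ l₃ _ _ _ _ _ _)
      (ih _ _ _ _)).mono (by omega)).of_eq ?_
    simp

/-- Run `a` on the input that is stored in register `K + j` and save its output in register
`K + 3 + j`; then run `b`. -/
def attemptThen (a : Prog) (K j : ℕ) (b : Prog) : Prog :=
  seq (clear K) <| seq (transfer (K + j) [0]) <| seq a <| seq (transfer 0 [K + (3 + j)]) b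

/-- A bound for the running time of `attemptThen`, up to that of the program that follows. -/
def attemptThenTime (K B t : ℕ) : ℕ := K * (2 * B + 2) + 100 * B + t + 100

/-- Written with the remaining program `b` as a continuation, so that its law may depend on the
vector `x` just found. Slot `j` holds the input, which is consumed, and slot `3 + j` receives the
output, reversed. -/
theorem outputs_attemptThen {a : Prog} {K : ℕ} (hK : 0 < K) (ha : a.Below K) {n t d B : ℕ}
    {D : PMF (List Bool)} (hD : ∀ x ∈ D.support, x.length ≤ d) {ν : PMF (Fin n → Bool)}
    (hν : Outputs D a (input [unary n]) t (ν.map List.ofFn)) (hB : n + t * (d + 1) ≤ B)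
    {b : Prog} {t' : ℕ} {κ : (Fin n → Bool) → PMF (List Bool)} {u : Memory}
    (hu : ∀ r < K, (u r).length ≤ B) {l : List (List Bool)} (hl : l.length = 6) {j : ℕ}
    (hj : j < 3) (hlj : l.getD j [] = unary n) (hlj' : l.getD (3 + j) [] = [])
    (hb : ∀ (x : Fin n → Bool) (u' : Memory), (∀ r < K, (u' r).length ≤ B) →
      Outputs D b (mem K u' ((l.set j []).set (3 + j) (List.ofFn x).reverse)) t' (κ x)) :
    Outputs D (attemptThen a K j b) (mem K u l) (attemptThenTime K B t + t') (ν.bind κ) := by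
  have hnB : n ≤ B := by omega
  have e1 := runs_clear_mem K u l hu
  have e2 := (runs_transfer (r := K + j) (ts := [0]) (by simp; omega) (by simp)
    (mem K (input [[], [], []]) l) (B := B)
    (by rw [mem_high, hlj]; simpa [unary] using hnB)).of_eq
    (s'' := mem K (input [unary n]) (l.set j []))
    (by
      rw [mem_high, hlj, update_mem_high _ _ _ (by omega)]
      simp only [appendAll, List.foldl_cons, List.foldl_nil, mem_low _ _ hK,
        update_mem_low _ _ hK]
      congr 1
      funext i
      rcases i with _ | _ | _ | i <;> simp [input, unary])
  obtain ⟨μ, hμ, hμν⟩ := hν.ends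
  have e3 := hμ.mem ha (l.set j [])
  have hdec : ∀ x : Fin n → Bool, (fun i : Fin n => (List.ofFn x).getD i false) = x := by
    intro x; funext i; simp
  have key := e3.seq_outputs (b := seq (transfer 0 [K + (3 + j)]) b)
    (u := 11 * B + 1 + t' + 1) (κ := fun s => κ fun i => (s 0).getD i false) (by
      intro s hs
      rw [PMF.mem_support_map_iff] at hs
      obtain ⟨u', hu', rfl⟩ := hs
      have hul : ∀ r, (u' r).length ≤ B := by
        intro r
        have := hμ.length_le hD hu' r
        have h3 : (input [unary n] r).length ≤ n := by
          rcases r with _ | r <;> simp [input, unary]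
        omega
      obtain ⟨x, -, hx⟩ : ∃ x ∈ ν.support, List.ofFn x = u' 0 := by
        rw [← PMF.mem_support_map_iff, ← hμν, PMF.mem_support_map_iff]
        exact ⟨u', hu', rfl⟩
      have e4 := (runs_transfer (r := 0) (ts := [K + (3 + j)]) (by simp; omega) (by simp)
        (mem K u' (l.set j [])) (B := B) (by rw [mem_low _ _ hK]; exact hul 0)).of_eq
        (s'' := mem K (Function.update u' 0 [])
          ((l.set j []).set (3 + j) (List.ofFn x).reverse))
        (by
          have h3 : (l.set j []).getD (3 + j) [] = [] := by
            rw [List.getD_eq_getElem?_getD, List.getElem?_set_ne (by omega),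
              ← List.getD_eq_getElem?_getD, hlj']
          simp only [appendAll, List.foldl_cons, List.foldl_nil, mem_low _ _ hK,
            update_mem_low _ _ hK, mem_high, h3]
          rw [update_mem_high _ _ _ (by simp; omega), hx, List.append_nil])
      have := e4.seq_outputs (hb x (Function.update u' 0 []) (by
        intro r _
        by_cases h : r = 0
        · subst h; simp
        · simpa [h] using hul r))
      simp only [mem_low _ _ hK, ← hx, hdec]
      exact this)
  have e : ((μ.map fun u' => mem K u' (l.set j [])).bind
      fun s => κ fun i => (s 0).getD i false) = ν.bind κ := by
    rw [PMF.bind_map]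
    have : (μ.map fun s => s 0).bind (fun v => κ fun i => v.getD i false) = ν.bind κ := by
      rw [hμν, PMF.bind_map]
      congr 1
      funext x
      simp only [Function.comp_apply, hdec]
    rw [← this, PMF.bind_map]
    congr 1
    funext s
    simp [mem_low, hK]
  rw [e] at key
  exact (e1.seq_outputs <| e2.seq_outputs key).mono (by unfold attemptThenTime; omega)

/-- Run `a` three times and take the majority of the outputs. -/
def thrice (a : Prog) (K : ℕ) : Prog :=
  seq (transfer 0 [K, K + 1, K + 2]) <| attemptThen a K 0 <| attemptThen a K 1 <|
  attemptThen a K 2 <| seq (clear K) (loop (K + 3) (vote (K + 3) (K + 4) (K + 5) 0))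

/-- A bound for the running time of `thrice`. -/
def thriceTime (K B t : ℕ) : ℕ := 4 * attemptThenTime K B t

theorem outputs_thrice {a : Prog} {K : ℕ} (hK : 3 ≤ K) (ha : a.Below K) {n t d B : ℕ}
    {D : PMF (List Bool)} (hD : ∀ x ∈ D.support, x.length ≤ d) {ν : PMF (Fin n → Bool)}
    (hν : Outputs D a (input [unary n]) t (ν.map List.ofFn)) (hB : n + t * (d + 1) ≤ B) :
    Outputs D (thrice a K) (input [unary n]) (thriceTime K B t)
      (ν.bind fun x => ν.bind fun y => ν.bind fun z =>
        PMF.pure (List.ofFn fun i => maj (x i) (y i) (z i))) := by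
  have h0 : 0 < K := by omega
  have hnB : n ≤ B := by omega
  have e1 := (runs_transfer (r := 0) (ts := [K, K + 1, K + 2]) (by simp; omega) (by simp)
    (mem K (input [unary n, [], []]) [[], [], [], [], [], []]) (B := B)
    (by simpa [mem_low, h0, input_apply, unary] using hnB)).of_eq
    (s'' := mem K (input [[], [], []]) [unary n, unary n, unary n, [], [], []])
    (by simp [appendAll, mem_low, update_mem_low, mem_high, update_mem_high, h0, input_apply,
      update_input, mem_high_zero, update_mem_high_zero, unary])
  have hlow : ∀ r < K, (input [[], [], []] r).length ≤ B := by
    intro r _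
    rcases r with _ | _ | _ | r <;> simp [input]
  have main : Outputs D (attemptThen a K 0 <| attemptThen a K 1 <|
      attemptThen a K 2 <| seq (clear K) (loop (K + 3) (vote (K + 3) (K + 4) (K + 5) 0)))
      (mem K (input [[], [], []]) [unary n, unary n, unary n, [], [], []])
      (attemptThenTime K B t + (attemptThenTime K B t + (attemptThenTime K B t +
        ((K * (2 * B + 2) + 1) + (11 * n + 1) + 1))))
      (ν.bind fun x => ν.bind fun y => ν.bind fun z =>
        PMF.pure (List.ofFn fun i => maj (x i) (y i) (z i))) := by
    refine outputs_attemptThen h0 ha hD hν hB hlow rfl (by omega) rfl rfl fun x u₁ hu₁ => ?_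
    refine outputs_attemptThen h0 ha hD hν hB hu₁ rfl (by omega) rfl rfl fun y u₂ hu₂ => ?_
    refine outputs_attemptThen h0 ha hD hν hB hu₂ rfl (by omega) rfl rfl fun z u₃ hu₃ => ?_
    have e2 := runs_clear_mem K u₃ [[], [], [], (List.ofFn x).reverse, (List.ofFn y).reverse,
      (List.ofFn z).reverse] hu₃
    have h := ((e2.seq (runs_votes h0 x y z _ _ _ _)).ends D).outputs
    rw [PMF.pure_map] at h
    simpa [mem_low, h0, input_apply] using h
  have key := e1.seq_outputs main
  rw [← input_eq_mem (unary n) (by simp) h0] at key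
  -- Three of the four summands pay for the runs of `a`, the fourth for copying the input, the last
  -- `clear` and the vote.
  exact key.mono (by unfold thriceTime attemptThenTime; omega)

end Prog

/-! ### Noisy parity is generated by an ISAN -/

namespace TimeVaryingISAN

theorem dist_apply {α : Type} [Fintype α] [Nonempty α] {d T : ℕ}
    (M : TimeVaryingISAN α d (T + 1)) (f : Fin (T + 1) → α) :
    M.dist f = softmax ((M.B 0).mulVec M.x₀) (f 0) * (M.next (f 0)).dist (Fin.tail f) := by
  classical
  rw [dist, PMF.bind_apply, tsum_eq_single (f 0)]
  · congr 1
    rw [PMF.map_apply, tsum_eq_single (Fin.tail f)]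
    · simp
    · intro g hg
      rw [if_neg]
      intro h
      exact hg (by rw [h, Fin.tail_cons])
  · intro a ha
    rw [mul_eq_zero]
    right
    rw [PMF.map_apply, ENNReal.tsum_eq_zero]
    intro g
    rw [if_neg]
    intro h
    exact ha (by rw [h, Fin.cons_zero])

end TimeVaryingISAN

/-- The state `(±1, 0)` with the sign of the parity `s`. -/
noncomputable def signState (s : Bool) : Fin 2 → ℝ := ![if s then -1 else 1, 0]

/-- The ISAN that generates noisy parity: its hidden state is the sign of the parity so far, and
only the last token depends on it. The initial parity is `s`. -/
noncomputable def parityISAN {n : ℕ} (y : Fin n → Bool) (logit : ℝ) (s : Bool) :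
    TimeVaryingISAN (Fin 2) 2 (n + 1) where
  A := fun a t =>
    if a = 1 ∧ (Fin.snoc y false : Fin (n + 1) → Bool) t = true then -1 else 1
  B := fun t a i => if t = Fin.last n ∧ a = 1 ∧ i = 0 then -logit else 0
  x₀ := signState s

theorem parity_zero (y z : Fin 0 → Bool) : parity y z = false := by simp [parity]

theorem parity_succ {n : ℕ} (y z : Fin (n + 1) → Bool) :
    parity y z = xor (y 0 && z 0) (parity (Fin.tail y) (Fin.tail z)) := by
  unfold parity
  rw [Fin.sum_univ_succ]
  have : ∀ a b : Bool, ∀ m : ℕ,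
      decide (Odd (a.toNat * b.toNat + m)) = xor (a && b) (decide (Odd m)) := by
    intro a b m
    cases a <;> cases b <;> simp [Nat.odd_add, ← Nat.not_odd_iff_even]
  exact this _ _ _

/-- The family is closed under reading a token: the state changes sign exactly if the token is 1 at
a selected position. This is why the initial parity is a parameter. -/
theorem next_parityISAN {n : ℕ} (y : Fin (n + 1) → Bool) (logit : ℝ) (s : Bool) (a : Fin 2) :
    (parityISAN y logit s).next a =
      parityISAN (Fin.tail y) logit (xor s (y 0 && finTwoEquiv a)) := by
  have hA : ∀ t : Fin (n + 1), (Fin.snoc y false : Fin (n + 2) → Bool) t.succ =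
      (Fin.snoc (Fin.tail y) false : Fin (n + 1) → Bool) t := by
    intro t
    induction t using Fin.lastCases with
    | last => rw [Fin.succ_last]; simp
    | cast t => rw [Fin.succ_castSucc, Fin.snoc_castSucc, Fin.snoc_castSucc]; rfl
  have h0 : (Fin.snoc y false : Fin (n + 2) → Bool) 0 = y 0 := by
    have : (0 : Fin (n + 2)) = Fin.castSucc 0 := rfl
    rw [this, Fin.snoc_castSucc]
  refine (TimeVaryingISAN.mk.injEq _ _ _ _ _ _).mpr ⟨?_, ?_, ?_⟩
  · funext b t
    simp only [parityISAN]
    rw [hA]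
  · funext t b i
    have : t.succ = Fin.last (n + 1) ↔ t = Fin.last n := by
      rw [← Fin.succ_last, Fin.succ_inj]
    simp only [parityISAN, this]
  · simp only [parityISAN, h0]
    fin_cases a <;> cases s <;> cases y 0 <;> ext i <;> fin_cases i <;>
      simp [signState, Matrix.neg_mulVec, finTwoEquiv]

theorem softmax_two_apply (v : Fin 2 → ℝ) (a : Fin 2) :
    softmax v a = ENNReal.ofReal (Real.exp (v a) / (Real.exp (v 0) + Real.exp (v 1))) := by
  rw [softmax, PMF.ofFintype_apply, Fin.sum_univ_two]

/-- The log-odds of the complement of a coin. -/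
noncomputable def logOdds (p : ℝ) : ℝ := Real.log ((1 - p) / p)

theorem biasedCoin_apply (p : Set.Ioo (0 : ℝ) (1 / 2)) (e : Bool) :
    biasedCoin p e = ENNReal.ofReal (if e then (p : ℝ) else 1 - p) := by
  rw [biasedCoin, PMF.ofFintype_apply]

/-- With sign σ the logits are 0 and -σ log((1-p)/p), so token 1 has odds p/(1-p) for even parity
and the inverse for odd parity. -/
theorem softmax_parityISAN_last (y : Fin 0 → Bool) (p : Set.Ioo (0 : ℝ) (1 / 2)) (s : Bool)
    (b : Bool) :
    softmax (((parityISAN y (logOdds p) s).B 0).mulVec (parityISAN y (logOdds p) s).x₀)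
      (finTwoEquiv.symm b) = biasedCoin p (xor s b) := by
  obtain ⟨p, h0, h1⟩ := p
  have h2 : 0 < 1 - p := by linarith
  have hexp : Real.exp (logOdds p) = (1 - p) / p := Real.exp_log (by positivity)
  have hexp' : Real.exp (-logOdds p) = p / (1 - p) := by rw [Real.exp_neg, hexp, inv_div]
  rw [softmax_two_apply, biasedCoin_apply]
  congr 1
  cases s <;> cases b <;>
    simp [parityISAN, signState, finTwoEquiv, Matrix.mulVec, dotProduct, hexp, hexp'] <;> field_simp <;> ring

theorem softmax_parityISAN_zero {n : ℕ} (y : Fin (n + 1) → Bool) (l : ℝ) (s : Bool) (a : Fin 2) :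
    softmax (((parityISAN y l s).B 0).mulVec (parityISAN y l s).x₀) a = 2⁻¹ := by
  rw [softmax_two_apply]
  have hz : (0 : Fin (n + 2)) ≠ Fin.last (n + 1) := (Fin.last_pos).ne
  have : ((parityISAN y l s).B 0) = 0 := by
    ext a i
    simp [parityISAN, hz]
  rw [this, Matrix.zero_mulVec]
  simp only [Pi.zero_apply, Real.exp_zero]
  norm_num [ENNReal.ofReal_div_of_pos]

/-- Every token but the last contributes a factor 1/2 and passes the updated parity on; induction on
`n` with `s` free. -/
theorem dist_parityISAN_apply {n : ℕ} (y : Fin n → Bool) (p : Set.Ioo (0 : ℝ) (1 / 2)) (s : Bool)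
    (x : Fin (n + 1) → Bool) :
    (parityISAN y (logOdds p) s).dist (fun i => finTwoEquiv.symm (x i)) =
      (2 ^ n)⁻¹ * biasedCoin p (xor s (xor (parity y (Fin.init x)) (x (Fin.last n)))) := by
  induction n generalizing s with
  | zero =>
    rw [TimeVaryingISAN.dist_apply, softmax_parityISAN_last, parity_zero]
    have : (TimeVaryingISAN.next (parityISAN y (logOdds p) s) (finTwoEquiv.symm (x 0))).dist
        (Fin.tail fun i => finTwoEquiv.symm (x i)) = 1 := by
      simp only [TimeVaryingISAN.dist]
      rw [PMF.pure_apply, if_pos (Subsingleton.elim _ _)]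
    rw [this]
    simp
  | succ n ih =>
    rw [TimeVaryingISAN.dist_apply, softmax_parityISAN_zero, next_parityISAN]
    have e : (Fin.tail fun i => finTwoEquiv.symm (x i)) =
        fun i => finTwoEquiv.symm (Fin.tail x i) := rfl
    rw [e, ih, ← mul_assoc, pow_succ',
      ENNReal.mul_inv (Or.inl (by norm_num)) (Or.inl (by norm_num))]
    congr 2
    rw [parity_succ y]
    have e2 : Fin.init (Fin.tail x) = Fin.tail (Fin.init x) := rfl
    have e3 : Fin.tail x (Fin.last n) = x (Fin.last (n + 1)) := rfl
    have e4 : Fin.init x 0 = x 0 := rfl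
    rw [e2, e3, e4]
    simp

theorem noisyParity_apply {n : ℕ} (y : Fin n → Bool) (p : Set.Ioo (0 : ℝ) (1 / 2))
    (x : Fin (n + 1) → Bool) :
    noisyParity y p x =
      (2 ^ n)⁻¹ * biasedCoin p (xor (parity y (Fin.init x)) (x (Fin.last n))) := by
  rw [noisyParity, PMF.bind_apply, tsum_eq_single (Fin.init x)]
  · rw [PMF.uniformOfFintype_apply, PMF.map_apply,
      tsum_eq_single (xor (parity y (Fin.init x)) (x (Fin.last n)))]
    · rw [if_pos (by simp)]
      simp
    · intro e he
      rw [if_neg]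
      intro h
      apply he
      have := congrFun h (Fin.last n)
      rw [Fin.snoc_last] at this
      rw [this]
      simp
  · intro z hz
    rw [mul_eq_zero]
    right
    rw [PMF.map_apply, ENNReal.tsum_eq_zero]
    intro e
    rw [if_neg]
    intro h
    apply hz
    rw [h, Fin.init_snoc]

theorem encodeTokens_two {T : ℕ} (x : Fin T → Fin 2) :
    encodeTokens x = List.ofFn fun i => finTwoEquiv (x i) := by
  have h : Nat.clog 2 2 = 1 := by decide
  have h1 : ∀ a : Fin 2, (List.ofFn fun j : Fin (Nat.clog 2 2) => (a : ℕ).testBit j) =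
      [finTwoEquiv a] := by
    intro a
    rw [List.ofFn_congr h]
    fin_cases a <;> simp [finTwoEquiv]
  have h2 : encodeTokens x = (List.ofFn x).flatMap fun a => [finTwoEquiv a] := by
    simp only [← h1, encodeTokens, List.bind_eq_flatMap, List.pure_def, List.flatMap_assoc]
    simp only [List.flatMap_cons, List.flatMap_nil, List.append_nil]
  rw [h2, ← List.map_eq_flatMap, List.map_ofFn]
  rfl

/-- The two laws agree as laws of bit strings, so `L` can be run on noisy parity samples without any
conversion. -/
theorem dist_parityISAN_map {n : ℕ} (y : Fin n → Bool) (p : Set.Ioo (0 : ℝ) (1 / 2)) :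
    (parityISAN y (logOdds p) false).dist.map encodeTokens = (noisyParity y p).map List.ofFn := by
  have : (encodeTokens : (Fin (n + 1) → Fin 2) → List Bool) =
      List.ofFn ∘ fun x i => finTwoEquiv (x i) := funext encodeTokens_two
  rw [this, ← PMF.map_comp]
  congr 1
  ext x
  rw [PMF.map_apply, tsum_eq_single fun i => finTwoEquiv.symm (x i)]
  · rw [if_pos (by simp), dist_parityISAN_apply, noisyParity_apply, Bool.false_xor]
  · intro f hf
    rw [if_neg]
    rintro rfl
    exact hf (by simp)

/-- A sample without its label supplies the uniform vector `z`. -/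
theorem noisyParity_map_init {n : ℕ} (y : Fin n → Bool) (p : Set.Ioo (0 : ℝ) (1 / 2)) :
    (noisyParity y p).map (Fin.init (α := fun _ => Bool)) =
      PMF.uniformOfFintype (Fin n → Bool) := by
  rw [noisyParity, PMF.map_bind]
  have : ∀ a : Fin n → Bool, (biasedCoin p).map (fun _ => a) = PMF.pure a :=
    fun a => PMF.map_const _ _
  simp [PMF.map_comp, Function.comp_def, this]

/-! ### Recovering the hidden vector from approximate probabilities -/

/-- The vector `z` with coordinate `i` negated. -/
def negateAt {n : ℕ} (z : Fin n → Bool) (i : Fin n) : Fin n → Bool := Function.update z i (!z i)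

theorem negateAt_negateAt {n : ℕ} (z : Fin n → Bool) (i : Fin n) :
    negateAt (negateAt z i) i = z := by
  simp [negateAt]

/-- The hidden vector, as it is suggested at `z` by a guess `h` for the parities. -/
def hiddenGuess {n : ℕ} (h : (Fin n → Bool) → Bool) (z : Fin n → Bool) : Fin n → Bool :=
  fun i => xor (h z) (h (negateAt z i))

theorem parity_negateAt {n : ℕ} (y z : Fin n → Bool) (i : Fin n) :
    parity y (negateAt z i) = xor (parity y z) (y i) := by
  induction n with
  | zero => exact i.elim0
  | succ n ih =>
    rw [parity_succ, parity_succ]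
    induction i using Fin.cases with
    | zero =>
      have : Fin.tail (negateAt z 0) = Fin.tail z := by
        funext j; simp [Fin.tail, negateAt]
      rw [this]
      simp only [negateAt, Function.update_self]
      cases y 0 <;> cases z 0 <;> simp
    | succ i =>
      have : Fin.tail (negateAt z i.succ) = negateAt (Fin.tail z) i := by
        funext j
        by_cases hj : j = i
        · subst hj; simp [Fin.tail, negateAt]
        · simp [Fin.tail, negateAt, hj]
      rw [this, ih]
      have h0 : negateAt z i.succ 0 = z 0 := by simp [negateAt, (Fin.succ_ne_zero i).symm]
      rw [h0]
      simp [Fin.tail]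

/-- If the guess `h` is wrong for `b` vectors, then for all but `16 * b` vectors it suggests a
vector that differs from the hidden one in less than an eighth of the coordinates. -/
theorem card_hiddenGuess_le {n : ℕ} (hn : 0 < n) (y : Fin n → Bool) (h : (Fin n → Bool) → Bool) :
    (Finset.univ.filter fun z => ¬ 8 * hammingDist y (hiddenGuess h z) < n).card ≤
      16 * (Finset.univ.filter fun z => h z ≠ parity y z).card := by
  classical
  set Bad := Finset.univ.filter fun z => h z ≠ parity y z with hBad
  -- If the guesses at `z` and at its neighbour are both right, their sum is `y i` by
  -- `parity_negateAt`.
  have hdist : ∀ z, hammingDist y (hiddenGuess h z) ≤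
      ∑ i, ((if z ∈ Bad then 1 else 0) + if negateAt z i ∈ Bad then 1 else 0) := by
    intro z
    rw [hammingDist, Finset.card_filter]
    refine Finset.sum_le_sum fun i _ => ?_
    by_cases h1 : z ∈ Bad
    · simp only [h1, if_true]; split_ifs <;> omega
    · by_cases h2 : negateAt z i ∈ Bad
      · simp only [h2, if_true]; split_ifs <;> omega
      · rw [if_neg]
        · omega
        · simp only [hBad, Finset.mem_filter, Finset.mem_univ, true_and, not_not] at h1 h2
          rw [hiddenGuess, h1, h2, parity_negateAt]
          simp
  -- Negating coordinate `i` is an involution, so it preserves the number of bad vectors.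
  have hflip : ∀ i : Fin n, (∑ z : Fin n → Bool, if negateAt z i ∈ Bad then 1 else 0) =
      Bad.card := by
    intro i
    have : (∑ z : Fin n → Bool, if negateAt z i ∈ Bad then 1 else 0) =
        ∑ z : Fin n → Bool, if z ∈ Bad then 1 else 0 :=
      Fintype.sum_equiv ⟨fun z => negateAt z i, fun z => negateAt z i,
        fun z => negateAt_negateAt z i, fun z => negateAt_negateAt z i⟩ _ _ fun z => rfl
    rw [this]
    simp
  have hsum : ∑ z : Fin n → Bool, hammingDist y (hiddenGuess h z) ≤ 2 * n * Bad.card := by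
    refine (Finset.sum_le_sum fun z _ => hdist z).trans ?_
    rw [Finset.sum_comm]
    have : ∀ i : Fin n, (∑ z : Fin n → Bool,
        ((if z ∈ Bad then 1 else 0) + if negateAt z i ∈ Bad then 1 else 0)) = 2 * Bad.card := by
      intro i
      rw [Finset.sum_add_distrib, hflip]
      simp; ring
    rw [Finset.sum_congr rfl fun i _ => this i]
    simp only [Finset.sum_const, Finset.card_univ, Fintype.card_fin, smul_eq_mul]
    exact le_of_eq (by ring)
  set Far := Finset.univ.filter fun z => ¬ 8 * hammingDist y (hiddenGuess h z) < n with hFar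
  -- Markov's inequality with threshold n/8.
  have hmarkov : Far.card * n ≤ 8 * ∑ z : Fin n → Bool, hammingDist y (hiddenGuess h z) := by
    rw [Finset.mul_sum, ← smul_eq_mul, ← Finset.sum_const]
    refine (Finset.sum_le_sum fun z hz => ?_).trans
      (Finset.sum_le_sum_of_subset (Finset.subset_univ Far))
    rw [hFar, Finset.mem_filter] at hz
    omega
  have : Far.card * n ≤ (16 * Bad.card) * n := by
    calc _ ≤ _ := hmarkov
      _ ≤ 8 * (2 * n * Bad.card) := Nat.mul_le_mul_left _ hsum
      _ = _ := by ring
  exact Nat.le_of_mul_le_mul_right this hn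

/-! ### Thresholding approximate probabilities -/

/-- Digits come least significant first, so dropping `c` of them is division by `2 ^ c`. A
disjunction of bits thus replaces arithmetic on the machine. -/
theorem Prog.any_drop_iff (l : List Bool) (c : ℕ) :
    (l.drop c).any id = true ↔ 2 ^ c ≤ Prog.toNat l := by
  induction c generalizing l with
  | zero =>
    simp only [List.drop_zero, pow_zero]
    induction l with
    | nil => simp [Prog.toNat]
    | cons b l ih =>
      have : Prog.toNat (b :: l) = b.toNat + 2 * Prog.toNat l := by
        simp [Prog.toNat, Nat.ofDigits_cons]
      rw [this, List.any_cons]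
      cases b with
      | false => simp only [id, Bool.false_or, ih, Bool.toNat_false]; omega
      | true => simp
  | succ c ih =>
    cases l with
    | nil => simp [Prog.toNat]
    | cons b l =>
      have : Prog.toNat (b :: l) = b.toNat + 2 * Prog.toNat l := by
        simp [Prog.toNat, Nat.ofDigits_cons]
      rw [this, List.drop_succ_cons, ih, pow_succ]
      have := Bool.toNat_le b
      omega

/-- A guess for the parities that is derived from approximations of the probabilities of a
distribution close to noisy parity is wrong for few vectors only. -/
theorem card_ne_parity_le {n : ℕ} (y : Fin n → Bool) (p : Set.Ioo (0 : ℝ) (1 / 2)) {p₀ : ℝ}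
    (hp : (p : ℝ) ≤ p₀) (hp₀ : p₀ < 1 / 2) {c : ℕ} (hc : 1 / 2 ^ (c + 1) ≤ (1 / 2 - p₀) / 2)
    {Q : PMF (Fin (n + 1) → Fin 2)}
    (hQ : tvDist Q (parityISAN y (logOdds p) false).dist ≤ (1 / 2 - p₀) / 1600)
    {a : (Fin n → Bool) → ℕ}
    (ha : ∀ z, |(a z : ℝ) / 2 ^ (n + 1 + c) -
      (Q fun i => finTwoEquiv.symm ((Fin.snoc z true : Fin (n + 1) → Bool) i)).toReal| ≤
        1 / 2 ^ (n + 1 + c)) :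
    400 * (Finset.univ.filter fun z => decide (2 ^ c ≤ a z) ≠ parity y z).card ≤ 2 ^ n := by
  classical
  set Bad := Finset.univ.filter fun z => decide (2 ^ c ≤ a z) ≠ parity y z with hBad
  set M := (parityISAN y (logOdds p) false).dist with hM
  set γ := 1 / 2 - p₀ with hγ
  have hγ0 : 0 < γ := by linarith
  let f : (Fin n → Bool) → Fin (n + 1) → Fin 2 :=
    fun z i => finTwoEquiv.symm ((Fin.snoc z true : Fin (n + 1) → Bool) i)
  have hf : Function.Injective f := by
    intro z z' hzz
    have : (Fin.snoc z true : Fin (n + 1) → Bool) = Fin.snoc z' true := by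
      funext i
      exact finTwoEquiv.symm.injective (congrFun hzz i)
    have := congrArg Fin.init this
    simpa [Fin.init_snoc] using this
  have hMf : ∀ z, (M (f z)).toReal = (1 / 2 ^ n) * if parity y z then 1 - (p : ℝ) else p := by
    intro z
    have h0 := p.2.1
    have h1 := p.2.2
    rw [hM, dist_parityISAN_apply, biasedCoin_apply, ENNReal.toReal_mul, Fin.init_snoc,
      Fin.snoc_last]
    cases parity y z
    · simp [ENNReal.toReal_ofReal h0.le]
    · simp [ENNReal.toReal_ofReal (show (0 : ℝ) ≤ 1 - p by linarith)]
  have hpow : (0 : ℝ) < 2 ^ n := by positivity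
  have hbad : ∀ z ∈ Bad, (1 / 2 ^ n) * (γ / 2) ≤ |(Q (f z)).toReal - (M (f z)).toReal| := by
    intro z hz
    have hz' : decide (2 ^ c ≤ a z) ≠ parity y z := by simpa [hBad] using hz
    have h := abs_le.1 (ha z)
    change -(1 / 2 ^ (n + 1 + c)) ≤ (a z : ℝ) / 2 ^ (n + 1 + c) - (Q (f z)).toReal ∧
      (a z : ℝ) / 2 ^ (n + 1 + c) - (Q (f z)).toReal ≤ 1 / 2 ^ (n + 1 + c) at h
    rw [hMf z]
    set q := (Q (f z)).toReal
    have e : ∀ r : ℝ, r / 2 ^ (n + 1 + c) = (1 / 2 ^ n) * (r * (1 / 2 ^ (c + 1))) := by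
      intro r
      rw [show n + 1 + c = n + (c + 1) by ring, pow_add]
      field_simp
    rw [e, e] at h
    -- In units of `2⁻ⁿ`, the threshold `2 ^ c` is the probability 1/2 and the evaluator's error is
    -- `δ ≤ γ / 2`.
    have e3 : (2 : ℝ) ^ c * (1 / 2 ^ (c + 1)) = 1 / 2 := by
      rw [pow_succ]; field_simp
    set δ : ℝ := 1 / 2 ^ (c + 1)
    have hδ : 0 < δ := by positivity
    set η : ℝ := 1 / 2 ^ n
    have hη : 0 < η := by positivity
    have hpp := p.2.1
    by_cases hza : 2 ^ c ≤ a z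
    · have hpar : parity y z = false := by
        rcases hy : parity y z
        · rfl
        · simp [hza, hy] at hz'
      rw [hpar]
      have hzr : (2 : ℝ) ^ c ≤ a z := by exact_mod_cast hza
      have h3 : 1 / 2 ≤ (a z : ℝ) * δ := by rw [← e3]; exact mul_le_mul_of_nonneg_right hzr hδ.le
      refine le_trans ?_ (le_abs_self _)
      have h4 : η * (1 / 2) ≤ η * (a z * δ) := mul_le_mul_of_nonneg_left h3 hη.le
      have h5 : η * δ ≤ η * (γ / 2) := mul_le_mul_of_nonneg_left hc hη.le
      have h6 : η * p ≤ η * p₀ := mul_le_mul_of_nonneg_left hp hη.le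
      simp only [Bool.false_eq_true, if_false]
      have h7 : η * γ = η * (1 / 2) - η * p₀ := by rw [hγ]; ring
      linarith [h.1, h.2]
    · have hpar : parity y z = true := by
        rcases hy : parity y z
        · simp [hza, hy] at hz'
        · rfl
      rw [hpar]
      have hzr : (a z : ℝ) + 1 ≤ 2 ^ c := by exact_mod_cast Nat.lt_of_not_le hza
      have h3 : ((a z : ℝ) + 1) * δ ≤ 1 / 2 := by
        rw [← e3]; exact mul_le_mul_of_nonneg_right hzr hδ.le
      refine le_trans ?_ (neg_le_abs _)
      have h4 : η * (((a z : ℝ) + 1) * δ) ≤ η * (1 / 2) := mul_le_mul_of_nonneg_left h3 hη.le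
      have h6 : η * p ≤ η * p₀ := mul_le_mul_of_nonneg_left hp hη.le
      simp only [if_true]
      have h7 : η * γ = η * (1 / 2) - η * p₀ := by rw [hγ]; ring
      have h8 : 0 < η * γ := by positivity
      linarith [h.1, h.2]
  -- The sequences `(z, 1)` are distinct, so the deviations at bad `z` are part of the sum that
  -- defines twice the distance.
  have hsum : (Bad.card : ℝ) * ((1 / 2 ^ n) * (γ / 2)) ≤ 2 * (γ / 1600) := by
    calc (Bad.card : ℝ) * ((1 / 2 ^ n) * (γ / 2)) = ∑ z ∈ Bad, (1 / 2 ^ n) * (γ / 2) := by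
          rw [Finset.sum_const, nsmul_eq_mul]
      _ ≤ ∑ z ∈ Bad, |(Q (f z)).toReal - (M (f z)).toReal| := Finset.sum_le_sum hbad
      _ = ∑ x ∈ Bad.map ⟨f, hf⟩, |(Q x).toReal - (M x).toReal| := by rw [Finset.sum_map]; rfl
      _ ≤ ∑ x, |(Q x).toReal - (M x).toReal| :=
          Finset.sum_le_univ_sum_of_nonneg fun x => abs_nonneg _
      _ = 2 * tvDist Q M := by rw [tvDist]; ring
      _ ≤ _ := by linarith
  have : 400 * (Bad.card : ℝ) ≤ 2 ^ n := by
    rw [show (Bad.card : ℝ) * ((1 / 2 ^ n) * (γ / 2)) = (Bad.card * γ / 2) / 2 ^ n by field_simp,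
      div_le_iff₀ hpow] at hsum
    have h9 : (400 * (Bad.card : ℝ)) * γ ≤ 2 ^ n * γ := by linarith
    exact le_of_mul_le_mul_right h9 hγ0
  exact_mod_cast this

/-! ### Majority of three independent attempts -/

theorem PMF.toOuterMeasure_bind_mono {α β γ : Type*} (p : PMF α) {f : α → PMF β} {g : α → PMF γ}
    {s : Set β} {t : Set γ} (h : ∀ a, (f a).toOuterMeasure s ≤ (g a).toOuterMeasure t) :
    (p.bind f).toOuterMeasure s ≤ (p.bind g).toOuterMeasure t := by
  rw [PMF.toOuterMeasure_bind_apply, PMF.toOuterMeasure_bind_apply]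
  exact ENNReal.tsum_le_tsum fun a => by gcongr; exact h a

/-- The majority is true with probability 3t² - 2t³, which increases on [0, 1] and exceeds 0.7 at t
= 16/25. -/
theorem two_thirds_le_maj (β : PMF Bool) (h : 16 / 25 ≤ β true) :
    2 / 3 ≤ (β.bind fun a => β.bind fun b => β.bind fun c =>
      PMF.pure (Prog.maj a b c)) true := by
  have hsum : β true + β false = 1 := by
    have := β.tsum_coe
    rwa [tsum_fintype, Fintype.sum_bool] at this
  simp only [PMF.bind_apply, tsum_fintype, Fintype.sum_bool, PMF.pure_apply, Prog.maj]
  simp only [Bool.and_self, Bool.or_self, Bool.and_false, Bool.and_true, Bool.or_false,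
    Bool.or_true, if_true, Bool.true_eq_false, if_false, mul_one, mul_zero,
    add_zero]
  have ht : β true ≠ ⊤ := β.apply_ne_top _
  have hf : β false ≠ ⊤ := β.apply_ne_top _
  generalize β true = t at *
  generalize β false = f at *
  lift t to NNReal using ht
  lift f to NNReal using hf
  have h1 : (t : ℝ) + f = 1 := by exact_mod_cast hsum
  have h2 : (16 / 25 : ℝ) ≤ t := by
    have : ((16 / 25 : NNReal) : ENNReal) ≤ t := by
      rwa [ENNReal.coe_div (by norm_num)]
    exact_mod_cast ENNReal.coe_le_coe.1 this
  have h3 : (0 : ℝ) ≤ f := f.2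
  have e : (2 / 3 : ENNReal) = ((2 / 3 : NNReal) : ENNReal) := by
    rw [ENNReal.coe_div (by norm_num)]; rfl
  rw [e]
  norm_cast
  rw [← NNReal.coe_le_coe]
  push_cast
  have hf' : (f : ℝ) = 1 - t := by linarith
  rw [hf']
  nlinarith [mul_nonneg (sub_nonneg.2 h2) (sub_nonneg.2 h2), mul_nonneg h3 (sub_nonneg.2 h2)]

/-- The majority errs only where at least one of two chosen vectors errs; for two good ones this
gives fewer than n/8 + n/8 errors. -/
theorem hammingDist_maj_lt {n : ℕ} {y a b c : Fin n → Bool}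
    (h : Prog.maj (decide (8 * hammingDist y a < n)) (decide (8 * hammingDist y b < n))
      (decide (8 * hammingDist y c < n)) = true) :
    4 * hammingDist y (fun i => Prog.maj (a i) (b i) (c i)) < n := by
  have key : ∀ u v w : Fin n → Bool, (∀ i, y i = u i → y i = v i → y i = w i) →
      hammingDist y w ≤ hammingDist y u + hammingDist y v := by
    intro u v w huvw
    unfold hammingDist
    refine (Finset.card_le_card fun i hi => ?_).trans (Finset.card_union_le _ _)
    simp only [Finset.mem_filter, Finset.mem_univ, true_and, Finset.mem_union] at hi ⊢
    by_contra hcon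
    push Not at hcon
    exact hi (huvw i hcon.1 hcon.2)
  have hab := key a b (fun i => Prog.maj (a i) (b i) (c i)) fun i h1 h2 => by
    simp only [Prog.maj, ← h1, ← h2]; cases y i <;> cases c i <;> rfl
  have hac := key a c (fun i => Prog.maj (a i) (b i) (c i)) fun i h1 h2 => by
    simp only [Prog.maj, ← h1, ← h2]; cases y i <;> cases b i <;> rfl
  have hbc := key b c (fun i => Prog.maj (a i) (b i) (c i)) fun i h1 h2 => by
    simp only [Prog.maj, ← h1, ← h2]; cases y i <;> cases a i <;> rfl
  simp only [Prog.maj, Bool.or_eq_true, Bool.and_eq_true, decide_eq_true_eq] at h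
  omega

theorem two_thirds_le_vote {n : ℕ} (y : Fin n → Bool) (ν : PMF (Fin n → Bool))
    (h : 16 / 25 ≤ ν.toOuterMeasure {x | 8 * hammingDist y x < n}) :
    2 / 3 ≤ (ν.bind fun a => ν.bind fun b => ν.bind fun c =>
      PMF.pure (List.ofFn fun i => Prog.maj (a i) (b i) (c i))).toOuterMeasure
        {w | ∃ y' : Fin n → Bool, w = List.ofFn y' ∧ 4 * hammingDist y y' < n} := by
  -- Only the success bit of each round matters; on the event that the majority of these bits is
  -- true, the vote succeeds.
  let χ : (Fin n → Bool) → Bool := fun x => decide (8 * hammingDist y x < n)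
  have hβ : 16 / 25 ≤ (ν.map χ) true := by
    rw [← PMF.toOuterMeasure_apply_singleton, PMF.toOuterMeasure_map_apply]
    refine h.trans (le_of_eq (congrArg _ ?_))
    ext x
    simp [χ]
  refine (two_thirds_le_maj _ hβ).trans ?_
  rw [← PMF.toOuterMeasure_apply_singleton]
  simp only [PMF.bind_map]
  refine PMF.toOuterMeasure_bind_mono _ fun a => ?_
  refine PMF.toOuterMeasure_bind_mono _ fun b => ?_
  refine PMF.toOuterMeasure_bind_mono _ fun c => ?_
  classical
  simp only [Function.comp_apply, PMF.toOuterMeasure_pure_apply, Set.mem_singleton_iff]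
  by_cases hm : Prog.maj (χ a) (χ b) (χ c) = true
  · rw [if_pos hm, if_pos ⟨_, rfl, hammingDist_maj_lt hm⟩]
  · rw [if_neg hm]
    exact zero_le

/-! ### Polynomial bounds -/

/-- The function `f` is bounded by a polynomial. -/
def PolyBounded (f : ℕ → ℕ) : Prop := ∃ q : Polynomial ℕ, ∀ n, f n ≤ q.eval n

theorem Polynomial.eval_mono_nat (q : Polynomial ℕ) {a b : ℕ} (h : a ≤ b) :
    q.eval a ≤ q.eval b := by
  rw [Polynomial.eval_eq_sum_range, Polynomial.eval_eq_sum_range]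
  exact Finset.sum_le_sum fun i _ => Nat.mul_le_mul_left _ (Nat.pow_le_pow_left h i)

namespace PolyBounded

theorem const (c : ℕ) : PolyBounded fun _ => c := ⟨Polynomial.C c, fun n => by simp⟩

theorem id : PolyBounded fun n => n := ⟨Polynomial.X, fun n => by simp⟩

theorem add {f g : ℕ → ℕ} (hf : PolyBounded f) (hg : PolyBounded g) :
    PolyBounded fun n => f n + g n := by
  obtain ⟨p, hp⟩ := hf
  obtain ⟨q, hq⟩ := hg
  exact ⟨p + q, fun n => by rw [Polynomial.eval_add]; exact Nat.add_le_add (hp n) (hq n)⟩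

theorem mul {f g : ℕ → ℕ} (hf : PolyBounded f) (hg : PolyBounded g) :
    PolyBounded fun n => f n * g n := by
  obtain ⟨p, hp⟩ := hf
  obtain ⟨q, hq⟩ := hg
  exact ⟨p * q, fun n => by rw [Polynomial.eval_mul]; exact Nat.mul_le_mul (hp n) (hq n)⟩

theorem eval {f : ℕ → ℕ} (hf : PolyBounded f) (q : Polynomial ℕ) :
    PolyBounded fun n => q.eval (f n) := by
  obtain ⟨p, hp⟩ := hf
  exact ⟨q.comp p, fun n => by rw [Polynomial.eval_comp]; exact q.eval_mono_nat (hp n)⟩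

theorem attemptTime (N c : ℕ) {f g : ℕ → ℕ} (hf : PolyBounded f) (hg : PolyBounded g) :
    PolyBounded fun n => Prog.attemptTime N c (f n) (g n) := by
  have hq : PolyBounded fun n => Prog.queryTime N c (f n) :=
    ((((const N).mul (((const 4).mul hf).add (const 2))).add ((const 200).mul hf)).add
      (const (2 * c))).add (const 100)
  have hd : PolyBounded fun n => Prog.decodeTime N c (f n) :=
    ((((hf.mul (hq.add (const 31))).add hq).add
      ((const N).mul (((const 4).mul hf).add (const 2)))).add ((const 100).mul hf)).add (const 100)
  exact (((hd.add hg).add ((const 100).mul hf)).add (const (2 * c))).add (const 100)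

theorem thriceTime (K : ℕ) {f g : ℕ → ℕ} (hf : PolyBounded f) (hg : PolyBounded g) :
    PolyBounded fun n => Prog.thriceTime K (f n) (g n) :=
  (const 4).mul (((((const K).mul (((const 2).mul hf).add (const 2))).add
    ((const 100).mul hf)).add hg).add (const 100))

end PolyBounded

/-! ### The reduction -/

theorem List.dropLast_ofFn {α : Type*} {n : ℕ} (x : Fin (n + 1) → α) :
    (List.ofFn x).dropLast = List.ofFn (Fin.init x : Fin n → α) := by
  rw [List.ofFn_succ', List.concat_eq_append, List.dropLast_concat]
  rfl

/-- Translates the scan along a list into coordinates; `zl` is free because the scan moves bits to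
the prefix. -/
theorem guesses_ofFn (g : List Bool → Bool) (base : Bool) {n : ℕ} (z : Fin n → Bool)
    (zl : List Bool) :
    Prog.guesses g base zl (List.ofFn z) =
      List.ofFn fun i => xor base (g (zl.reverse ++ (List.ofFn (negateAt z i) ++ [true]))) := by
  induction n generalizing zl with
  | zero => rfl
  | succ n ih =>
    rw [List.ofFn_succ, Prog.guesses, ih, List.ofFn_succ]
    congr 1
    · congr 3
      rw [List.ofFn_succ]
      simp [negateAt, (Fin.succ_ne_zero _)]
    · congr 1
      funext i
      congr 2
      rw [List.ofFn_succ (f := negateAt z i.succ)]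
      have h0 : negateAt z i.succ 0 = z 0 := by simp [negateAt, (Fin.succ_ne_zero i).symm]
      have h1 : (fun j : Fin n => negateAt z i.succ j.succ) =
          negateAt (fun j : Fin n => z j.succ) i := by
        funext j
        by_cases hj : j = i
        · subst hj; simp [negateAt]
        · simp [negateAt, hj]
      rw [h0, h1]
      simp

theorem ofFn_snoc_true {n : ℕ} (z : Fin n → Bool) :
    List.ofFn (Fin.snoc z true : Fin (n + 1) → Bool) = List.ofFn z ++ [true] := by
  rw [List.ofFn_succ', List.concat_eq_append]
  simp

/-- The output of one attempt, when the samples are noisy parities. -/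
theorem bind_map_guesses {n : ℕ} (y : Fin n → Bool) (p : Set.Ioo (0 : ℝ) (1 / 2))
    (g : List Bool → List Bool → Bool) (ν : PMF (List Bool)) :
    (ν.bind fun w => ((noisyParity y p).map List.ofFn).map fun x =>
      Prog.guesses (g w) (g w (x.dropLast ++ [true])) [] x.dropLast) =
    (ν.bind fun w => (PMF.uniformOfFintype (Fin n → Bool)).map
      (hiddenGuess fun z => g w (List.ofFn z ++ [true]))).map List.ofFn := by
  rw [PMF.map_bind]
  congr 1
  funext w
  rw [PMF.map_comp, PMF.map_comp, ← noisyParity_map_init y p, PMF.map_comp]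
  congr 1
  funext x
  simp only [Function.comp_apply, List.dropLast_ofFn, guesses_ofFn, List.reverse_nil,
    List.nil_append]
  rfl

/-- At most 16 · 2ⁿ/400 = 2ⁿ/25 vectors `z` are unfavourable. -/
theorem le_uniform_hiddenGuess {n : ℕ} (hn : 0 < n) (y : Fin n → Bool)
    {h : (Fin n → Bool) → Bool}
    (hh : 400 * (Finset.univ.filter fun z => h z ≠ parity y z).card ≤ 2 ^ n) :
    24 / 25 ≤ ((PMF.uniformOfFintype (Fin n → Bool)).map (hiddenGuess h)).toOuterMeasure
      {x | 8 * hammingDist y x < n} := by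
  classical
  have hcard := card_hiddenGuess_le hn y h
  rw [PMF.toOuterMeasure_map_apply, PMF.toOuterMeasure_uniformOfFintype_apply]
  have h1 : Fintype.card ↑(hiddenGuess h ⁻¹' {x | 8 * hammingDist y x < n}) =
      (Finset.univ.filter fun z => 8 * hammingDist y (hiddenGuess h z) < n).card :=
    Fintype.card_of_subtype _ fun z => by simp
  have h2 := Finset.card_filter_add_card_filter_not
    (s := (Finset.univ : Finset (Fin n → Bool)))
    (fun z => 8 * hammingDist y (hiddenGuess h z) < n)
  rw [Finset.card_univ, Fintype.card_fun, Fintype.card_bool, Fintype.card_fin] at h2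
  rw [h1, Fintype.card_fun, Fintype.card_bool, Fintype.card_fin]
  set G := (Finset.univ.filter fun z => 8 * hammingDist y (hiddenGuess h z) < n).card
  have h3 : 24 * 2 ^ n ≤ 25 * G := by omega
  rw [ENNReal.le_div_iff_mul_le (by left; positivity) (by left; simp), mul_comm,
    ← mul_div_assoc, ENNReal.div_le_iff_le_mul (by simp) (by simp)]
  have : (2 ^ n * 24 : ℕ) ≤ G * 25 := by omega
  exact_mod_cast this

/-- A learner for the ISANs with two tokens and two hidden dimensions yields a solution of noisy
parity. -/
theorem solvesNoisyParity_of_learnsISANs {p₀ : ℝ} (hp₀ : p₀ < 1 / 2)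
    {P : Set (Set.Ioo (0 : ℝ) (1 / 2))} (hP : ∀ p ∈ P, (p : ℝ) ≤ p₀) {L E : Prog}
    (hLE : LearnsISANs 2 2 ((1 / 2 - p₀) / 1600) L E) : ∃ S, SolvesNoisyParity P S := by
  obtain ⟨⟨hEdet, qE, hqE⟩, qL, hqL⟩ := hLE
  obtain ⟨c, hc⟩ : ∃ c : ℕ, (1 : ℝ) / 2 ^ (c + 1) ≤ (1 / 2 - p₀) / 2 := by
    obtain ⟨c, hc⟩ := exists_pow_lt_of_lt_one (show (0 : ℝ) < (1 / 2 - p₀) / 2 by linarith)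
      (show (1 / 2 : ℝ) < 1 by norm_num)
    refine ⟨c, le_trans ?_ hc.le⟩
    rw [← one_div_pow, pow_succ]
    have : (0 : ℝ) < (1 / 2) ^ c := by positivity
    linarith
  choose ev hev using fun (w x : List Bool) (m : ℕ) =>
    Prog.Deterministic.exists_runs hEdet (hqE w x m)
  obtain ⟨N₁, hN₁⟩ := L.exists_below
  obtain ⟨N₂, hN₂⟩ := E.exists_below
  set N := N₁ + N₂ + 3 with hN
  obtain ⟨K₁, hK₁⟩ := (Prog.attempt L E N c).exists_below
  set K := K₁ + 3 with hK
  set tL : ℕ → ℕ := fun n => qL.eval (n + 1) with htL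
  -- Bounds the registers after `L`: inputs of length at most `n + 3`, and at most `n + 2` more bits
  -- per step.
  set W : ℕ → ℕ := fun n => n + 3 + tL n * (n + 2) with hW
  -- One bound for the lengths of the description, the sequence and the precision, and for the time
  -- of the evaluator on them.
  set B : ℕ → ℕ := fun n => W n + (n + 1 + c) + qE.eval (W n + (n + 1) + (n + 1 + c)) with hBdef
  set T₁ : ℕ → ℕ := fun n => Prog.attemptTime N c (B n) (tL n) with hT₁
  set B₁ : ℕ → ℕ := fun n => n + T₁ n * (n + 2) with hB₁
  have ptL : PolyBounded tL := (PolyBounded.id.add (.const 1)).eval qL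
  have pW : PolyBounded W :=
    (PolyBounded.id.add (.const 3)).add (ptL.mul (PolyBounded.id.add (.const 2)))
  have pc : PolyBounded fun n => n + 1 + c := (PolyBounded.id.add (.const 1)).add (.const c)
  have pB : PolyBounded B :=
    (pW.add pc).add (((pW.add (PolyBounded.id.add (.const 1))).add pc).eval qE)
  have pT₁ : PolyBounded T₁ := .attemptTime N c pB ptL
  have pB₁ : PolyBounded B₁ := PolyBounded.id.add (pT₁.mul (PolyBounded.id.add (.const 2)))
  obtain ⟨q, hq⟩ := PolyBounded.thriceTime K pB₁ pT₁
  refine ⟨Prog.thrice (Prog.attempt L E N c) K, q, fun n hn y p hp => ?_⟩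
  intro D s
  have hlen : ∀ x ∈ D.support, x.length = n + 1 := by
    intro x hx
    rw [PMF.mem_support_map_iff] at hx
    obtain ⟨f, -, rfl⟩ := hx
    simp
  have hDM : (parityISAN y (logOdds p) false).dist.map encodeTokens = D := dist_parityISAN_map y p
  have hL := hqL (n + 1) (parityISAN y (logOdds p) false)
  simp only [hDM] at hL
  obtain ⟨hLhalt, hLprob⟩ := hL
  set ν := Prog.output D L
    (Prog.input [Prog.unary (n + 1), Prog.unary 2, Prog.unary 2]) (tL n) with hν
  let g : List Bool → List Bool → Bool :=
    fun w x => ((ev w x (n + 1 + c) 0).drop c).any id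
  have hattempt := Prog.outputs_attempt (L := L) (E := E) (N := N) (by omega)
    (hN₁.mono (by omega)) (hN₂.mono (by omega)) c (B := B n) (t := tL n) hlen
    (ν := ν) ⟨hLhalt, rfl⟩ (g := g) (fun w x hw hx => ⟨ev w x (n + 1 + c),
      (hev w x (n + 1 + c)).mono (by
        refine le_trans (qE.eval_mono_nat ?_) (Nat.le_add_left _ _)
        rw [hx]
        simp only [hW] at hw ⊢
        omega), rfl⟩) (by simp only [hBdef, hW]; omega) (by simp only [hBdef]; omega)
  rw [show D = (noisyParity y p).map List.ofFn from rfl, bind_map_guesses] at hattempt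
  set ν' := ν.bind fun w => (PMF.uniformOfFintype (Fin n → Bool)).map
      (hiddenGuess fun z => g w (List.ofFn z ++ [true])) with hν'
  have hthrice := (Prog.outputs_thrice (K := K) (by omega) (hK₁.mono (by omega)) (d := n + 1)
    (B := B₁ n) (fun x hx => (hlen x hx).le) hattempt le_rfl).mono (hq n)
  refine ⟨hthrice.1, ?_⟩
  rw [hthrice.2]
  refine two_thirds_le_vote y ν' ?_
  rw [hν', PMF.toOuterMeasure_bind_apply]
  set good : Set (List Bool) := {w | ∃ Q : PMF (Fin (n + 1) → Fin 2), Describes E w Q ∧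
    tvDist Q (parityISAN y (logOdds p) false).dist ≤ (1 / 2 - p₀) / 1600} with hgood
  have hw : ∀ w ∈ good, 24 / 25 ≤ ((PMF.uniformOfFintype (Fin n → Bool)).map
      (hiddenGuess fun z => g w (List.ofFn z ++ [true]))).toOuterMeasure
        {x | 8 * hammingDist y x < n} := by
    rintro w ⟨Q, hdesc, htv⟩
    refine le_uniform_hiddenGuess hn y ?_
    have h := card_ne_parity_le y p (hP p hp) hp₀ hc htv
      (a := fun z => Prog.toNat (ev w (List.ofFn z ++ [true]) (n + 1 + c) 0)) (fun z => by
        obtain ⟨t, s', hrun, hs'⟩ := hdesc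
          (fun i => finTwoEquiv.symm ((Fin.snoc z true : Fin (n + 1) → Bool) i)) (n + 1 + c)
        have henc : encodeTokens (fun i => finTwoEquiv.symm
            ((Fin.snoc z true : Fin (n + 1) → Bool) i)) = List.ofFn z ++ [true] := by
          rw [encodeTokens_two, ← ofFn_snoc_true]
          simp only [Equiv.apply_symm_apply]
        rw [henc] at hrun
        rw [(hev w _ _).eq_of_run_eq hrun] at hs'
        exact hs')
    refine le_trans (le_of_eq ?_) h
    congr 2
    refine Finset.filter_congr fun z _ => ?_
    have : g w (List.ofFn z ++ [true]) =
        decide (2 ^ c ≤ Prog.toNat (ev w (List.ofFn z ++ [true]) (n + 1 + c) 0)) := by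
      rw [Bool.eq_iff_iff, decide_eq_true_eq]
      exact Prog.any_drop_iff _ _
    rw [this]
  have hLprob' : 2 / 3 ≤ ν.toOuterMeasure good := hLprob
  -- Descriptions outside `good` are given weight zero.
  calc (16 / 25 : ENNReal) = 2 / 3 * (24 / 25) := by
        rw [← ENNReal.toReal_eq_toReal_iff' (by finiteness) (by finiteness)]
        simp
        norm_num
    _ ≤ ν.toOuterMeasure good * (24 / 25) := by gcongr
    _ = ∑' w, good.indicator ν w * (24 / 25) := by
        rw [PMF.toOuterMeasure_apply, ENNReal.tsum_mul_right]
    _ ≤ _ := by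
        refine ENNReal.tsum_le_tsum fun w => ?_
        by_cases hwg : w ∈ good
        · rw [Set.indicator_of_mem hwg]
          gcongr
          exact hw w hwg
        · rw [Set.indicator_of_notMem hwg, zero_mul]
          exact zero_le

theorem mainTheorem3 (p₀ : ℝ) (hp₀ : p₀ < 1 / 2) :
    ∃ ε : ℝ, 0 < ε ∧
      ∀ P : Set (Set.Ioo (0 : ℝ) (1 / 2)), (∀ p ∈ P, (p : ℝ) ≤ p₀) →
        NoisyParityHard P → ¬ ∃ L E : Prog, LearnsISANs 2 2 ε L E :=
  -- With γ = 1/2 - p₀, the fraction of wrong guesses is at most 2ε/(γ/2) = 1/400, which the factor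
  -- 16 turns into 1/25.
  ⟨(1 / 2 - p₀) / 1600, by linarith, fun _ hP hhard ⟨_, _, hLE⟩ =>
    hhard (solvesNoisyParity_of_learnsISANs hp₀ hP hLE)⟩
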